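/- **Setting.** Consider a finite stochastic game with players $i\in\mathcal N$, states $\mathcal S$, finite action sets $\mathcal A_i$ ($\mathcal A=\prod_i\mathcal A_i$), rewards $r_i:\mathcal S\times\mathcal A\to[-1,1]$, transition probabilities $P(s'\mid s,a)$, stopping probabilities $\zeta_{s,a}=1-\sum_{s'}P(s'\mid s,a)>0$ and initial state distribution $\rho$. Let $\Pi=\prod_i\Delta(\mathcal A_i)^{\mathcal S}$ be the set of stationary Markovian policy profiles, with the Euclidean norm, let $V_{i,\rho}(\pi)$ be the expected total reward collected by player $i$ until the game stops when play follows $\pi$ and the initial state is drawn from $\rho$, and let $v(\pi)=(\nabla_{\pi_i}V_{i,\rho}(\pi))_{i}$. (As a sum over finite trajectories of probability times total reward, $V_{i,\rho}$ extends to a neighborhood of $\Pi$ in the ambient space, where the gradients are taken.) A policy $\pi^*\in\Pi$ is *Nash* if $V_{i,\rho}(\pi_i;\pi^*_{-i})\le V_{i,\rho}(\pi^*)$ for all $i$ and all $\pi_i$; a Nash policy is *second-order stationary* if $(\pi-\pi^*)^\top \mathrm{Jac}_v(\pi^*)(\pi-\pi^*)<0$ for all $\pi\in\Pi\setminus\{\pi^*\}$.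 Policy gradient with parameters $\gamma>0$, $m\ge 0$, $p\in(1/2,1]$ is a random sequence in $\Pi$ with $$\pi_{n+1}=\mathrm{proj}_\Pi\Big(\pi_n+\frac{\gamma}{(n+m)^p}\,\hat V_n\Big),\qquad n=1,2,\dots,$$ where, with $\mathcal F_n=\sigma(\pi_1,\dots,\pi_n)$, $U_n=\hat V_n-\mathbb E[\hat V_n\mid\mathcal F_n]$ and $b_n=\mathbb E[\hat V_n\mid\mathcal F_n]-v(\pi_n)$, one has $\mathbb E[\|b_n\|\mid\mathcal F_n]\le B_n$ and $\mathbb E[\|U_n\|^2\mid\mathcal F_n]\le\sigma_n^2$ for given deterministic sequences $B_n=O(n^{-\ell_b})$ and $\sigma_n=O(n^{\ell_\sigma})$, with $\ell_\sigma\ge0$, $p+\ell_b>1$ and $p-\ell_\sigma>1/2$. **Theorem.** Let $\pi^*$ be a Nash policy. If $\pi^*$ is second-order stationary, then there are $\mu>0$ and a neighborhood $\mathcal B$ of $\pi^*$ in $\Pi$ with $$\langle v(\pi),\pi-\pi^*\rangle\le-\mu\|\pi-\pi^*\|^2\qquad\text{for all }\pi\in\mathcal B.\tag{1}$$ Moreover,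 let $\mu>0$ and let $\mathcal B$ be any (measurable) neighborhood of $\pi^*$ in $\Pi$ satisfying (1). Fix $\gamma,p,\ell_b,\ell_\sigma,(B_n),(\sigma_n)$ as above, and for a policy gradient sequence $(\pi_n)$ let $\mathcal E=\{\pi_n\in\mathcal B\text{ for all }n=1,2,\dots\}$. Then: 1. There is a neighborhood $\mathcal U$ of $\pi^*$ in $\Pi$ such that for every $\delta>0$ there is $m_0\ge 0$ such that, for every $m\ge m_0$ and every policy gradient sequence with $\mathbb P(\pi_1\in\mathcal U)>0$, $$\mathbb P(\mathcal E\mid\pi_1\in\mathcal U)\ge1-\delta\qquad\text{and}\qquad \mathbb P(\pi_n\to\pi^*\mid\pi_1\in\mathcal U)\ge1-\delta.$$ 2. For every $m\ge0$ and every policy gradient sequence, $\pi_n\to\pi^*$ almost surely on $\mathcal E$, and, with $q=\min\{\ell_b,\,p-2\ell_\sigma\}$ and conditioned on $\mathcal E$ (whenever $\mathbb P(\mathcal E)>0$), $$\mathbb E\big[\|\pi_n-\pi^*\|^2\mid\mathcal E\big]=\begin{cases}O(n^{-2\mu\gamma})&\text{if }p=1\text{ and }2\mu\gamma<q,\\ O(n^{-q})&\text{otherwise.}\end{cases}$$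 -/

import Mathlib

open MeasureTheory Filter Topology Asymptotics

/-- A finite stochastic game with random stopping: players `I`, states `S`, action sets `A i`,
rewards in `[-1, 1]`, sub-stochastic transitions `trans s a s'` (the remaining mass
`1 - ∑ s', trans s a s'` is the probability, always positive, that the episode terminates), and a
distribution `init` of the initial state. -/
structure StochasticGame (I S : Type*) (A : I → Type*) [Fintype S] where
  reward : I → S → (∀ i, A i) → ℝ
  trans : S → (∀ i, A i) → S → ℝ
  init : S → ℝ
  reward_mem : ∀ i s a, reward i s a ∈ Set.Icc (-1 : ℝ) 1
  trans_nonneg : ∀ s a s', 0 ≤ trans s a s'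
  stop_pos : ∀ s a, 0 < 1 - ∑ s', trans s a s'
  init_nonneg : ∀ s, 0 ≤ init s
  init_sum : ∑ s, init s = 1

namespace StochasticGame

/-- The ambient Euclidean space `∏ i, (ℝ^{A i})^S` of policy profiles; the coordinate `⟨i, s, a⟩`
of a policy profile is the probability that player `i` plays `a` at state `s`. -/
abbrev Profile (I S : Type*) (A : I → Type*) : Type _ := EuclideanSpace ℝ (Σ i : I, S × A i)

noncomputable section

variable {I S : Type*} {A : I → Type*} [Fintype I] [DecidableEq I] [Fintype S] [DecidableEq S]
  [∀ i, Fintype (A i)]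

/-- The set `Π = ∏ i, Δ(A i)^S` of stationary Markovian policy profiles. -/
def policies (I S : Type*) (A : I → Type*) [∀ i, Fintype (A i)] : Set (Profile I S A) :=
  {π | ∀ (i : I) (s : S), (∀ a : A i, 0 ≤ π ⟨i, s, a⟩) ∧ ∑ a : A i, π ⟨i, s, a⟩ = 1}

/-- The probability that the episode terminates after the action profile `a` is played at `s`. -/
def stopProb (G : StochasticGame I S A) (s : S) (a : ∀ i, A i) : ℝ :=
  1 - ∑ s', G.trans s a s'

/-- The probability, under `π` and given the initial state `s`, that the episode is exactly the
finite trajectory `τ = ((s₀, a₀), …, (s_T, a_T))`, the process terminating after step `T`. The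
formula is polynomial in `π`, hence makes sense for every `π` in the ambient space. -/
def trajProb (G : StochasticGame I S A) (π : Profile I S A) (s : S) {T : ℕ}
    (τ : Fin (T + 1) → S × (∀ i, A i)) : ℝ :=
  (if (τ 0).1 = s then 1 else 0)
    * (∏ t : Fin (T + 1), ∏ i : I, π ⟨i, (τ t).1, (τ t).2 i⟩)
    * (∏ t : Fin T, G.trans (τ t.castSucc).1 (τ t.castSucc).2 (τ t.succ).1)
    * G.stopProb (τ (Fin.last T)).1 (τ (Fin.last T)).2

/-- The value function `V_{i,s}(π)`: the expectation, over the random trajectory started at `s`, of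
the total reward of player `i` collected until termination. -/
def valueFrom (G : StochasticGame I S A) (i : I) (s : S) (π : Profile I S A) : ℝ :=
  ∑' T : ℕ, ∑ τ : Fin (T + 1) → S × (∀ i, A i),
    G.trajProb π s τ * ∑ t : Fin (T + 1), G.reward i (τ t).1 (τ t).2

/-- The value function `V_{i,ρ}(π) = E_{s ∼ ρ} V_{i,s}(π)`, with `ρ` the initial distribution. -/
def value (G : StochasticGame I S A) (i : I) (π : Profile I S A) : ℝ :=
  ∑ s, G.init s * G.valueFrom i s π

/-- The ensemble `v(π) = (∇_i V_{i,ρ}(π))_i` of individual policy gradients. -/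
def gradField (G : StochasticGame I S A) (π : Profile I S A) : Profile I S A :=
  WithLp.toLp 2 fun k => gradient (G.value k.1) π k

/-- Nash policies: no player gains by a unilateral deviation. -/
def IsNash (G : StochasticGame I S A) (π' : Profile I S A) : Prop :=
  π' ∈ policies I S A ∧ ∀ (i : I), ∀ π ∈ policies I S A,
    (∀ j, j ≠ i → ∀ s a, π ⟨j, s, a⟩ = π' ⟨j, s, a⟩) → G.value i π ≤ G.value i π'

/-- Second-order stationary policies: Nash policies at which the Jacobian `Jac_v` satisfies
`(π - π')ᵀ Jac_v(π') (π - π') < 0` for every policy `π ≠ π'`. -/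
def IsSecondOrderStationary (G : StochasticGame I S A) (π' : Profile I S A) : Prop :=
  G.IsNash π' ∧ ∀ π ∈ policies I S A, π ≠ π' →
    inner ℝ (π - π') (fderiv ℝ G.gradField π' (π - π')) < 0

/-- The quadratic bound `⟨v(π), π - π'⟩ ≤ -μ ‖π - π'‖²` for all `π ∈ B`. -/
def QuadraticBoundOn (G : StochasticGame I S A) (π' : Profile I S A) (μ : ℝ)
    (B : Set (Profile I S A)) : Prop :=
  ∀ π ∈ B, inner ℝ (G.gradField π) (π - π') ≤ -μ * ‖π - π'‖ ^ 2

/-- `y` is the Euclidean projection of `x` onto the policy space. -/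
def IsProjection (x y : Profile I S A) : Prop :=
  y ∈ policies I S A ∧ ∀ z ∈ policies I S A, ‖x - y‖ ≤ ‖x - z‖

/-- The step-size `γ / (n + m)^p`. -/
def stepSize (γ m p : ℝ) (n : ℕ) : ℝ := γ / ((n : ℝ) + m) ^ p

section Dynamics

variable {Ω : Type*} [MeasurableSpace Ω]

/-- The history `F_n = σ(π_1, …, π_n)`. -/
@[reducible] def history (π : ℕ → Ω → Profile I S A) (n : ℕ) : MeasurableSpace Ω :=
  ⨆ k ∈ Finset.Icc 1 n, MeasurableSpace.comap (π k) inferInstance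

/-- The bias `b_n = E[V̂_n | F_n] - v(π_n)` of the gradient signal. -/
def bias (G : StochasticGame I S A) (P : Measure Ω) (π V : ℕ → Ω → Profile I S A) (n : ℕ) :
    Ω → Profile I S A :=
  fun ω => (condExp (history π n) P (V n)) ω - G.gradField (π n ω)

/-- The noise `U_n = V̂_n - E[V̂_n | F_n]` of the gradient signal. -/
def noise (P : Measure Ω) (π V : ℕ → Ω → Profile I S A) (n : ℕ) : Ω → Profile I S A :=
  fun ω => V n ω - (condExp (history π n) P (V n)) ω

/-- `π_1, π_2, …` is generated by policy gradient, `π_{n+1} = proj_Π (π_n + γ_n V̂_n)`, with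
step-size `γ_n = γ / (n + m)^p` and gradient signals `V̂_n` whose bias and noise satisfy
`E[‖b_n‖ | F_n] ≤ bb n` and `E[‖U_n‖² | F_n] ≤ (sd n)²`. The index `0` is not used. Square
integrability of `V̂_n` is what the latter bounds entail for genuine conditional expectations; it
is stated because Mathlib's `condExp` of a non-integrable function is `0`. -/
structure IsPolicyGradient (G : StochasticGame I S A) (P : Measure Ω) (γ m p : ℝ)
    (bb sd : ℕ → ℝ) (π V : ℕ → Ω → Profile I S A) : Prop where
  measurable : ∀ n, 1 ≤ n → Measurable (π n)
  init_mem : ∀ ω, π 1 ω ∈ policies I S A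
  signal_memLp : ∀ n, 1 ≤ n → MemLp (V n) 2 P
  update : ∀ n, 1 ≤ n → ∀ ω, IsProjection (π n ω + stepSize γ m p n • V n ω) (π (n + 1) ω)
  bias_le : ∀ n, 1 ≤ n →
    condExp (history π n) P (fun ω => ‖G.bias P π V n ω‖) ≤ᵐ[P] fun _ => bb n
  noise_le : ∀ n, 1 ≤ n →
    condExp (history π n) P (fun ω => ‖noise P π V n ω‖ ^ 2) ≤ᵐ[P] fun _ => sd n ^ 2

/-- The event that `π_n ∈ B` for all `n = 1, 2, …`. -/
def stayEvent (π : ℕ → Ω → Profile I S A) (B : Set (Profile I S A)) : Set Ω :=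
  {ω | ∀ n, 1 ≤ n → π n ω ∈ B}

/-- The event that `π_n` converges to `π'`. -/
def convergeEvent (π : ℕ → Ω → Profile I S A) (π' : Profile I S A) : Set Ω :=
  {ω | Tendsto (fun n => π n ω) atTop (𝓝 π')}

end Dynamics

end

end StochasticGame

/-!
Near a Nash policy `π'`, the projected policy gradient process is followed through the squared
distance `D_n = ‖π_n - π'‖²`. Since the projection is nonexpansive, one step increases `D_n` by
at most `2 γ_n ⟨V_n, π_n - π'⟩ + γ_n² ‖V_n‖²`, and the quadratic bound turns the mean of the
first term into a drift `-2 μ γ_n D_n`, up to the bias. Everything probabilistic is read off from this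
inequality (`IsPolicyGradient.setIntegral_succ_le`), integrated over events of the past and applied
to suitable convex functions `φ(D_n)` in place of `D_n`:

* containment, with `φ(D) = ((D - r²)⁺)²`, which vanishes at the start and of which each exit from
  the basin consumes a fixed amount, while the total error is small for large `m`
  (`IsPolicyGradient.measure_diff_stayEvent_le`);
* the rates, through the recursions of Chung `isBigO_of_recursion` and `isBigO_of_recursion_slow`
  (`IsPolicyGradient.isBigO_stayUpTo`);
* almost sure convergence, by martingale convergence and the vanishing of the mean
  (`IsPolicyGradient.ae_tendsto`).

The boundary case `p = 1`, `2 μ γ = q` of the rates is not covered by Chung's recursion for `D_n`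
itself, which would lose a logarithm. It holds because the quadratic bound makes `π'` strict: by the
Bellman equation, the value of a player is a linear fractional function of a deviation of that
player at a single state, so if its derivative vanished at `π'` the value would be constant along
the deviation, contradicting the bound (`value_line_eq_of_deriv_eq_zero`, `IsNash.inner_block_neg`).
Hence the drift is linear in the distance near `π'`, and the function `D + D² / r` contracts with a
constant larger than `μ` on the whole basin.

The value function is smooth near the policy space since, by splitting off the first move of a
trajectory, it solves a linear system whose matrix `1 - M(π)` is strictly diagonally dominant there
(`contDiffAt_value`). At a second-order stationary policy the quadratic bound is then the
first-order expansion of the gradient field, made uniform by the closedness of the tangent cone of the polytope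
of policies (`exists_le_neg_of_feasible`).
-/

namespace StochasticGame

noncomputable section

variable {I S : Type*} {A : I → Type*} [Fintype I] [DecidableEq I] [Fintype S] [DecidableEq S]
  [∀ i, Fintype (A i)]

/-! ### Bellman equations for the value function -/

/-- The weight `∏ i, π_i(a_i | s)` of the action profile `a` at the state `s`. -/
def weight (π : Profile I S A) (s : S) (a : ∀ i, A i) : ℝ := ∏ i, π ⟨i, s, a i⟩

/-- The sub-stochastic matrix of transitions between states when play follows `π`. -/
def transMatrix (G : StochasticGame I S A) (π : Profile I S A) : Matrix S S ℝ :=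
  fun s s' => ∑ a, weight π s a * G.trans s a s'

/-- The total weight of the trajectories from `s` that make exactly `T + 1` moves. -/
def lengthProb (G : StochasticGame I S A) (π : Profile I S A) (T : ℕ) (s : S) : ℝ :=
  ∑ τ : Fin (T + 1) → S × (∀ i, A i), G.trajProb π s τ

/-- The contribution to the value function of the trajectories that make exactly `T + 1` moves. -/
def lengthReward (G : StochasticGame I S A) (i : I) (π : Profile I S A) (T : ℕ) (s : S) : ℝ :=
  ∑ τ : Fin (T + 1) → S × (∀ i, A i), G.trajProb π s τ * ∑ t, G.reward i (τ t).1 (τ t).2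

/-- A neighborhood of the policy space on which all trajectory sums converge: the absolute row
sums of the transition weights are less than one. -/
def domain (G : StochasticGame I S A) : Set (Profile I S A) :=
  {π | ∀ s, ∑ a, |weight π s a| * ∑ s', G.trans s a s' < 1}

omit [DecidableEq I] [∀ i, Fintype (A i)] in
lemma trajProb_cons (G : StochasticGame I S A) (π : Profile I S A) (s : S) {T : ℕ}
    (x : S × (∀ i, A i)) (τ : Fin (T + 1) → S × (∀ i, A i)) :
    G.trajProb π s (Fin.cons x τ : Fin (T + 2) → S × (∀ i, A i)) =
      if x.1 = s then weight π x.1 x.2 * ∑ s', G.trans x.1 x.2 s' * G.trajProb π s' τ else 0 := by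
  have h : ∑ s', G.trans x.1 x.2 s' * G.trajProb π s' τ =
      G.trans x.1 x.2 (τ 0).1 * G.trajProb π (τ 0).1 τ := by
    refine Finset.sum_eq_single _ (fun b _ hb => ?_) (by simp)
    simp [trajProb, Ne.symm hb]
  rw [h]
  have htr : ∀ f : Fin (T + 2) → S × (∀ i, A i), ∏ t : Fin (T + 1),
      G.trans (f t.castSucc).1 (f t.castSucc).2 (f t.succ).1 =
      G.trans (f 0).1 (f 0).2 (f 1).1 * ∏ t : Fin T,
        G.trans (f t.castSucc.succ).1 (f t.castSucc.succ).2 (f t.succ.succ).1 := fun f => by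
    rw [Fin.prod_univ_succ]
    rfl
  have hl : Fin.last (T + 1) = (Fin.last T).succ := rfl
  have h1 : (1 : Fin (T + 2)) = Fin.succ 0 := rfl
  simp only [trajProb]
  rw [htr, Fin.prod_univ_succ (n := T + 1)]
  simp only [Fin.cons_zero, Fin.cons_succ, hl, h1]
  by_cases hx : x.1 = s
  · simp only [hx, if_true, weight]
    ring
  · simp [hx]

lemma sum_cons {X : Type*} [Fintype X] {T : ℕ} (f : (Fin (T + 2) → X) → ℝ) :
    ∑ τ, f τ = ∑ x, ∑ τ : Fin (T + 1) → X, f (Fin.cons x τ : Fin (T + 2) → X) := by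
  rw [← Fintype.sum_prod_type']
  exact (Fintype.sum_equiv (Fin.consEquiv fun _ : Fin (T + 2) => X) _ _ fun x => rfl).symm

lemma lengthProb_zero (G : StochasticGame I S A) (π : Profile I S A) (s : S) :
    G.lengthProb π 0 s = ∑ a, weight π s a * G.stopProb s a := by
  unfold lengthProb
  rw [← (Equiv.funUnique (Fin 1) (S × (∀ i, A i))).symm.sum_comp, Fintype.sum_prod_type,
    Finset.sum_eq_single s (fun b _ hb => ?_) (by simp)]
  · simp [trajProb, weight]
  · simp [trajProb, hb]

lemma lengthReward_zero (G : StochasticGame I S A) (i : I) (π : Profile I S A) (s : S) :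
    G.lengthReward i π 0 s = ∑ a, weight π s a * G.stopProb s a * G.reward i s a := by
  unfold lengthReward
  rw [← (Equiv.funUnique (Fin 1) (S × (∀ i, A i))).symm.sum_comp, Fintype.sum_prod_type,
    Finset.sum_eq_single s (fun b _ hb => ?_) (by simp)]
  · simp [trajProb, weight]
  · simp [trajProb, hb]

lemma lengthProb_succ (G : StochasticGame I S A) (π : Profile I S A) (T : ℕ) (s : S) :
    G.lengthProb π (T + 1) s =
      ∑ a, weight π s a * ∑ s', G.trans s a s' * G.lengthProb π T s' := by
  unfold lengthProb
  rw [sum_cons, Fintype.sum_prod_type, Finset.sum_eq_single s (fun b _ hb => ?_) (by simp)]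
  · refine Finset.sum_congr rfl fun a _ => ?_
    simp only [trajProb_cons, if_true, ← Finset.mul_sum]
    rw [Finset.sum_comm]
    simp only [Finset.mul_sum]
  · simp [trajProb_cons, hb]

lemma lengthReward_succ (G : StochasticGame I S A) (i : I) (π : Profile I S A) (T : ℕ) (s : S) :
    G.lengthReward i π (T + 1) s = ∑ a, weight π s a * ∑ s', G.trans s a s' *
      (G.reward i s a * G.lengthProb π T s' + G.lengthReward i π T s') := by
  unfold lengthReward lengthProb
  rw [sum_cons, Fintype.sum_prod_type, Finset.sum_eq_single s (fun b _ hb => ?_) (by simp)]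
  · refine Finset.sum_congr rfl fun a _ => ?_
    simp only [trajProb_cons, if_true, Fin.sum_univ_succ (n := T + 1), Fin.cons_zero, Fin.cons_succ,
      mul_assoc, ← Finset.mul_sum, Finset.sum_mul]
    congr 1
    rw [Finset.sum_comm]
    refine Finset.sum_congr rfl fun s' _ => ?_
    rw [← Finset.mul_sum, Finset.mul_sum (a := G.reward i s a), ← Finset.sum_add_distrib]
    congr 1
    refine Finset.sum_congr rfl fun τ _ => ?_
    ring
  · simp [trajProb_cons, hb]

omit [DecidableEq S] in
lemma sum_weight_mul_le (G : StochasticGame I S A) {π : Profile I S A} {s : S} {lam c : ℝ}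
    (h : ∑ a, |weight π s a| * ∑ s', G.trans s a s' ≤ lam) (hc : 0 ≤ c)
    {f : (∀ i, A i) → S → ℝ} (hf : ∀ a s', |f a s'| ≤ c) :
    |∑ a, weight π s a * ∑ s', G.trans s a s' * f a s'| ≤ lam * c := by
  calc |∑ a, weight π s a * ∑ s', G.trans s a s' * f a s'|
      ≤ ∑ a, |weight π s a| * ∑ s', G.trans s a s' * c := by
        refine (Finset.abs_sum_le_sum_abs _ _).trans (Finset.sum_le_sum fun a _ => ?_)
        rw [abs_mul]
        refine mul_le_mul_of_nonneg_left ?_ (abs_nonneg _)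
        refine (Finset.abs_sum_le_sum_abs _ _).trans (Finset.sum_le_sum fun s' _ => ?_)
        rw [abs_mul, abs_of_nonneg (G.trans_nonneg s a s')]
        exact mul_le_mul_of_nonneg_left (hf a s') (G.trans_nonneg s a s')
    _ = (∑ a, |weight π s a| * ∑ s', G.trans s a s') * c := by
        simp only [← Finset.sum_mul, ← mul_assoc]
    _ ≤ lam * c := mul_le_mul_of_nonneg_right h hc

omit [DecidableEq I] [DecidableEq S] [Fintype I] [∀ i, Fintype (A i)] in
lemma nonempty_states (G : StochasticGame I S A) : Nonempty S := by
  by_contra h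
  rw [not_nonempty_iff] at h
  simpa using G.init_sum

omit [DecidableEq S] in
lemma exists_rowSum_le (G : StochasticGame I S A) {π : Profile I S A} (h : π ∈ G.domain) :
    ∃ lam : ℝ, 0 ≤ lam ∧ lam < 1 ∧ ∀ s, ∑ a, |weight π s a| * ∑ s', G.trans s a s' ≤ lam := by
  have := G.nonempty_states
  obtain ⟨s₀, hs₀⟩ := Finite.exists_max fun s => ∑ a, |weight π s a| * ∑ s', G.trans s a s'
  exact ⟨_, Finset.sum_nonneg fun a _ => mul_nonneg (abs_nonneg _)
    (Finset.sum_nonneg fun s' _ => G.trans_nonneg _ _ _), h s₀, hs₀⟩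

/-- On the domain, the contribution of the trajectories with `T + 1` moves decays
geometrically in `T`, up to a linear factor. -/
lemma exists_length_bound (G : StochasticGame I S A) (i : I) {π : Profile I S A}
    (h : π ∈ G.domain) : ∃ C lam : ℝ, 0 ≤ lam ∧ lam < 1 ∧ ∀ T s,
      |G.lengthProb π T s| ≤ C * lam ^ T ∧ |G.lengthReward i π T s| ≤ C * ((T + 1) * lam ^ T) := by
  obtain ⟨lam, h0, h1, hlam⟩ := G.exists_rowSum_le h
  set C : ℝ := ∑ s, ∑ a, |weight π s a * G.stopProb s a| with hC
  have hC0 : 0 ≤ C := Finset.sum_nonneg fun s _ => Finset.sum_nonneg fun a _ => abs_nonneg _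
  have hr : ∀ s a, |G.reward i s a| ≤ 1 := fun s a => abs_le.2 (G.reward_mem i s a)
  have hCs : ∀ s, ∑ a, |weight π s a * G.stopProb s a| ≤ C := fun s =>
    Finset.single_le_sum (f := fun s => ∑ a, |weight π s a * G.stopProb s a|)
      (fun s _ => Finset.sum_nonneg fun a _ => abs_nonneg _) (Finset.mem_univ s)
  refine ⟨C, lam, h0, h1, fun T => ?_⟩
  induction T with
  | zero =>
    intro s
    constructor
    · rw [lengthProb_zero]
      simpa using (Finset.abs_sum_le_sum_abs _ _).trans (hCs s)
    · rw [lengthReward_zero]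
      simp only [CharP.cast_eq_zero, zero_add, pow_zero, mul_one]
      refine (Finset.abs_sum_le_sum_abs _ _).trans ((Finset.sum_le_sum fun a _ => ?_).trans (hCs s))
      rw [abs_mul]
      exact mul_le_of_le_one_right (abs_nonneg _) (hr s a)
  | succ T ih =>
    intro s
    have hp : 0 ≤ lam ^ T := pow_nonneg h0 T
    constructor
    · rw [lengthProb_succ]
      refine (G.sum_weight_mul_le (hlam s) (mul_nonneg hC0 hp)
        (f := fun _ s' => G.lengthProb π T s') fun a s' => (ih s').1).trans_eq ?_
      ring
    · rw [lengthReward_succ]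
      refine (G.sum_weight_mul_le (hlam s) (c := C * ((T + 2) * lam ^ T)) (by positivity)
        (f := fun a s' => G.reward i s a * G.lengthProb π T s' + G.lengthReward i π T s')
        fun a s' => ?_).trans_eq ?_
      · refine (abs_add_le _ _).trans ?_
        have h2 : |G.reward i s a * G.lengthProb π T s'| ≤ C * lam ^ T := by
          rw [abs_mul]
          exact (mul_le_of_le_one_left (abs_nonneg _) (hr s a)).trans (ih s').1
        linarith [(ih s').2]
      · push_cast
        ring

lemma summable_length (G : StochasticGame I S A) (i : I) {π : Profile I S A}
    (h : π ∈ G.domain) (s : S) :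
    (Summable fun T => G.lengthProb π T s) ∧ Summable fun T => G.lengthReward i π T s := by
  obtain ⟨C, lam, h0, h1, hb⟩ := G.exists_length_bound i h
  have hg : Summable fun T : ℕ => lam ^ T := summable_geometric_of_lt_one h0 h1
  have hn : ‖lam‖ < 1 := by rwa [Real.norm_of_nonneg h0]
  have hg' : Summable fun T : ℕ => ((T : ℝ) + 1) * lam ^ T := by
    have := (summable_pow_mul_geometric_of_norm_lt_one 1 hn).add hg
    refine this.congr fun T => ?_
    ring
  exact ⟨(hg.mul_left C).of_norm_bounded fun T => (hb T s).1,
    (hg'.mul_left C).of_norm_bounded fun T => (hb T s).2⟩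

/-- The total weight of all finite trajectories started at `s`. It equals one on the policy
space, but not in general. -/
def totalProb (G : StochasticGame I S A) (π : Profile I S A) (s : S) : ℝ :=
  ∑' T, G.lengthProb π T s

lemma valueFrom_eq (G : StochasticGame I S A) (i : I) (π : Profile I S A) (s : S) :
    G.valueFrom i s π = ∑' T, G.lengthReward i π T s := rfl

omit [DecidableEq S] in
lemma sum_transMatrix_mul (G : StochasticGame I S A) (π : Profile I S A) (s : S) (f : S → ℝ) :
    ∑ s', G.transMatrix π s s' * f s' = ∑ a, weight π s a * ∑ s', G.trans s a s' * f s' := by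
  simp only [transMatrix, Finset.sum_mul, Finset.mul_sum]
  rw [Finset.sum_comm]
  simp only [mul_assoc]

lemma totalProb_eq (G : StochasticGame I S A) {π : Profile I S A} (h : π ∈ G.domain)
    (i : I) (s : S) : G.totalProb π s = ∑ a, weight π s a * G.stopProb s a +
      ∑ a, weight π s a * ∑ s', G.trans s a s' * G.totalProb π s' := by
  have hs := fun s => (G.summable_length i h s).1
  rw [totalProb, (hs s).tsum_eq_zero_add, lengthProb_zero]
  congr 1
  simp only [lengthProb_succ]
  refine HasSum.tsum_eq ?_
  refine hasSum_sum fun a _ => HasSum.mul_left _ ?_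
  exact hasSum_sum fun s' _ => HasSum.mul_left _ (hs s').hasSum

lemma valueFrom_eq_add (G : StochasticGame I S A) {π : Profile I S A} (h : π ∈ G.domain)
    (i : I) (s : S) : G.valueFrom i s π = ∑ a, weight π s a * G.stopProb s a * G.reward i s a +
      ∑ a, weight π s a * ∑ s', G.trans s a s' *
        (G.reward i s a * G.totalProb π s' + G.valueFrom i s' π) := by
  have hs := fun s => (G.summable_length i h s)
  rw [valueFrom_eq, (hs s).2.tsum_eq_zero_add, lengthReward_zero]
  congr 1
  simp only [lengthReward_succ]
  refine HasSum.tsum_eq ?_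
  refine hasSum_sum fun a _ => HasSum.mul_left _ ?_
  refine hasSum_sum fun s' _ => HasSum.mul_left _ ?_
  exact ((hs s').1.hasSum.mul_left _).add (hs s').2.hasSum

/-! ### Smoothness of the value function near the policy space -/

omit [DecidableEq S] [DecidableEq I] in
lemma contDiff_weight (s : S) (a : ∀ i, A i) {n : WithTop ℕ∞} :
    ContDiff ℝ n fun π : Profile I S A => weight π s a := by
  unfold weight
  exact contDiff_prod fun i _ => by fun_prop

omit [DecidableEq S] in
lemma isOpen_domain (G : StochasticGame I S A) : IsOpen G.domain := by
  have : G.domain = ⋂ s, {π | ∑ a, |weight π s a| * ∑ s', G.trans s a s' < 1} := by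
    ext; simp [domain]
  rw [this]
  refine isOpen_iInter_of_finite fun s => isOpen_lt ?_ continuous_const
  refine continuous_finsetSum _ fun a _ => Continuous.mul ?_ continuous_const
  exact ((contDiff_weight s a (n := 0)).continuous).abs

omit [DecidableEq S] [Fintype S] in
lemma sum_weight {π : Profile I S A} (h : π ∈ policies I S A) (s : S) :
    ∑ a, weight π s a = 1 := by
  unfold weight
  rw [← Fintype.prod_sum fun i (a : A i) => π ⟨i, s, a⟩]
  simp [(h _ _).2]

omit [DecidableEq S] [Fintype S] [DecidableEq I] in
lemma weight_nonneg {π : Profile I S A} (h : π ∈ policies I S A) (s : S) (a : ∀ i, A i) :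
    0 ≤ weight π s a :=
  Finset.prod_nonneg fun i _ => (h i s).1 _

omit [DecidableEq S] in
lemma policies_subset_domain (G : StochasticGame I S A) : policies I S A ⊆ G.domain := by
  intro π h s
  have h1 := sum_weight h s
  rw [← h1]
  have hne : ∃ a ∈ Finset.univ, 0 < weight π s a := by
    by_contra hcon
    push Not at hcon
    have : ∑ a, weight π s a ≤ 0 := Finset.sum_nonpos hcon
    linarith
  obtain ⟨a₀, ha₀, hpos⟩ := hne
  refine Finset.sum_lt_sum (fun a _ => ?_) ⟨a₀, ha₀, ?_⟩
  · rw [abs_of_nonneg (weight_nonneg h s a)]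
    exact mul_le_of_le_one_right (weight_nonneg h s a) (by linarith [G.stop_pos s a])
  · rw [abs_of_nonneg (weight_nonneg h s a₀)]
    exact mul_lt_of_lt_one_right hpos (by linarith [G.stop_pos s a₀])

/-- `1 - M(π)` is strictly diagonally dominant on the domain. -/
lemma det_one_sub_ne_zero (G : StochasticGame I S A) {π : Profile I S A} (h : π ∈ G.domain) :
    (1 - G.transMatrix π).det ≠ 0 := by
  refine det_ne_zero_of_sum_row_lt_diag fun s => ?_
  have hrow : ∑ s', |G.transMatrix π s s'| < 1 := by
    refine lt_of_le_of_lt ?_ (h s)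
    calc ∑ s', |G.transMatrix π s s'| ≤ ∑ s', ∑ a, |weight π s a| * G.trans s a s' := by
          refine Finset.sum_le_sum fun s' _ => (Finset.abs_sum_le_sum_abs _ _).trans_eq ?_
          simp only [abs_mul, abs_of_nonneg (G.trans_nonneg _ _ _)]
      _ = _ := by rw [Finset.sum_comm]; simp only [Finset.mul_sum]
  rw [← Finset.add_sum_erase _ _ (Finset.mem_univ s)] at hrow
  have h1 : ∑ j ∈ Finset.univ.erase s, ‖(1 - G.transMatrix π) s j‖ =
      ∑ j ∈ Finset.univ.erase s, |G.transMatrix π s j| := by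
    refine Finset.sum_congr rfl fun j hj => ?_
    rw [Matrix.sub_apply, Matrix.one_apply_ne (Finset.ne_of_mem_erase hj).symm]
    simp
  rw [h1, Matrix.sub_apply, Matrix.one_apply_eq, Real.norm_eq_abs]
  have := abs_sub_abs_le_abs_sub 1 (G.transMatrix π s s)
  rw [abs_one] at this
  linarith

/-- The solution of a linear system depends as smoothly on parameters as its coefficients do. -/
lemma contDiffAt_of_mulVec_eq {E : Type*} [NormedAddCommGroup E] [NormedSpace ℝ E]
    {n : WithTop ℕ∞} {M : E → Matrix S S ℝ} {b W : E → S → ℝ} {x : E}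
    (hM : ∀ s s', ContDiffAt ℝ n (fun y => M y s s') x)
    (hb : ∀ s, ContDiffAt ℝ n (fun y => b y s) x)
    (hdet : (M x).det ≠ 0) (heq : ∀ᶠ y in 𝓝 x, (M y).mulVec (W y) = b y) (s : S) :
    ContDiffAt ℝ n (fun y => W y s) x := by
  have hdetC : ∀ N : E → Matrix S S ℝ, (∀ s s', ContDiffAt ℝ n (fun y => N y s s') x) →
      ContDiffAt ℝ n (fun y => (N y).det) x := by
    intro N hN
    simp only [Matrix.det_apply]
    refine ContDiffAt.sum fun σ _ => ContDiffAt.const_smul _ ?_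
    exact contDiffAt_prod fun i _ => hN _ _
  have hnum : ContDiffAt ℝ n (fun y => ((M y).updateCol s (b y)).det) x := by
    refine hdetC _ fun i j => ?_
    simp only [Matrix.updateCol_apply]
    by_cases hj : j = s
    · simpa [hj] using hb i
    · simpa [hj] using hM i j
  refine (hnum.div (hdetC _ hM) hdet).congr_of_eventuallyEq ?_
  have hne : ∀ᶠ y in 𝓝 x, (M y).det ≠ 0 := (hdetC _ hM).continuousAt.eventually_ne hdet
  filter_upwards [heq, hne] with y hy hy'
  rw [Pi.div_apply, eq_div_iff hy', ← Matrix.cramer_apply, Matrix.cramer_eq_adjugate_mulVec, ← hy,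
    Matrix.mulVec_mulVec, Matrix.adjugate_mul, Matrix.smul_mulVec, Matrix.one_mulVec]
  simp [mul_comm]

lemma one_sub_mulVec (G : StochasticGame I S A) (π : Profile I S A) (f : S → ℝ) (s : S) :
    (1 - G.transMatrix π).mulVec f s =
      f s - ∑ a, weight π s a * ∑ s', G.trans s a s' * f s' := by
  rw [← sum_transMatrix_mul, Matrix.sub_mulVec, Matrix.one_mulVec]
  rfl

lemma contDiffAt_valueFrom (G : StochasticGame I S A) (i : I) {π : Profile I S A}
    (h : π ∈ G.domain) {n : WithTop ℕ∞} (s : S) :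
    ContDiffAt ℝ n (fun y => G.valueFrom i s y) π := by
  have hev : ∀ᶠ y in 𝓝 π, y ∈ G.domain := G.isOpen_domain.mem_nhds h
  have hw : ∀ s a, ContDiffAt ℝ n (fun π : Profile I S A => weight π s a) π :=
    fun s a => (contDiff_weight s a).contDiffAt
  have hM : ∀ s s', ContDiffAt ℝ n (fun y => (1 - G.transMatrix y) s s') π := by
    intro s s'
    simp only [Matrix.sub_apply, transMatrix]
    exact contDiffAt_const.sub (ContDiffAt.sum fun a _ => (hw s a).mul contDiffAt_const)
  have hq : ∀ s, ContDiffAt ℝ n (fun y => G.totalProb y s) π := by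
    refine contDiffAt_of_mulVec_eq (b := fun y s => ∑ a, weight y s a * G.stopProb s a) hM
      (fun s => ContDiffAt.sum fun a _ => (hw s a).mul contDiffAt_const)
      (G.det_one_sub_ne_zero h) ?_
    filter_upwards [hev] with y hy
    ext s
    rw [one_sub_mulVec]
    linarith [G.totalProb_eq hy i s]
  refine contDiffAt_of_mulVec_eq (W := fun y s => G.valueFrom i s y)
    (b := fun y s => ∑ a, weight y s a * G.stopProb s a * G.reward i s a +
      ∑ a, weight y s a * ∑ s', G.trans s a s' * (G.reward i s a * G.totalProb y s')) hM
    (fun s => ?_) (G.det_one_sub_ne_zero h) ?_ s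
  · refine ContDiffAt.add (ContDiffAt.sum fun a _ => ?_) (ContDiffAt.sum fun a _ => ?_)
    · exact ((hw s a).mul contDiffAt_const).mul contDiffAt_const
    · exact (hw s a).mul (ContDiffAt.sum fun s' _ =>
        contDiffAt_const.mul (contDiffAt_const.mul (hq s')))
  filter_upwards [hev] with y hy
  ext s
  rw [one_sub_mulVec, G.valueFrom_eq_add hy i s]
  simp only [mul_add, Finset.sum_add_distrib]
  ring

lemma contDiffAt_value (G : StochasticGame I S A) (i : I) {π : Profile I S A} (h : π ∈ G.domain)
    {n : WithTop ℕ∞} : ContDiffAt ℝ n (G.value i) π := by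
  unfold value
  exact ContDiffAt.sum fun s _ => contDiffAt_const.mul (G.contDiffAt_valueFrom i h s)

lemma differentiableAt_gradField (G : StochasticGame I S A) {π : Profile I S A}
    (h : π ∈ G.domain) : DifferentiableAt ℝ G.gradField π := by
  rw [differentiableAt_euclidean]
  intro k
  have h1 : DifferentiableAt ℝ (fderiv ℝ (G.value k.1)) π :=
    ((G.contDiffAt_value k.1 h (n := 2)).fderiv_right (m := 1) (by norm_num)).differentiableAt
      (by norm_num)
  have h2 : DifferentiableAt ℝ (gradient (G.value k.1)) π :=
    (InnerProductSpace.toDual ℝ (Profile I S A)).symm.toContinuousLinearEquiv.differentiableAt.comp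
      π h1
  exact (differentiableAt_euclidean.1 h2) k

/-- On the policy space the weights of all trajectories add up to one. -/
lemma totalProb_eq_one (G : StochasticGame I S A) {π : Profile I S A} (h : π ∈ policies I S A)
    (i : I) (s : S) : G.totalProb π s = 1 := by
  have hd := G.policies_subset_domain h
  have h1 : (1 - G.transMatrix π).mulVec (fun s => G.totalProb π s - 1) = 0 := by
    ext s
    rw [one_sub_mulVec]
    have h2 := G.totalProb_eq hd i s
    have h3 := sum_weight h s
    have h4 : ∑ a, weight π s a * G.stopProb s a =
        1 - ∑ a, weight π s a * ∑ s', G.trans s a s' := by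
      simp only [stopProb, mul_sub, mul_one, Finset.sum_sub_distrib, h3]
    simp only [mul_sub, mul_one, Finset.sum_sub_distrib, Pi.zero_apply]
    linarith
  have := congrFun (Matrix.eq_zero_of_mulVec_eq_zero (G.det_one_sub_ne_zero hd) h1) s
  simpa [sub_eq_zero] using this

/-- The expected return of player `i` when `a` is played at `s` and play then follows `π`. -/
def actionValue (G : StochasticGame I S A) (i : I) (π : Profile I S A) (s : S)
    (a : ∀ i, A i) : ℝ :=
  G.reward i s a + ∑ s', G.trans s a s' * G.valueFrom i s' π

lemma valueFrom_eq_sum_actionValue (G : StochasticGame I S A) {π : Profile I S A}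
    (h : π ∈ policies I S A) (i : I) (s : S) :
    G.valueFrom i s π = ∑ a, weight π s a * G.actionValue i π s a := by
  rw [G.valueFrom_eq_add (G.policies_subset_domain h) i s, ← Finset.sum_add_distrib]
  refine Finset.sum_congr rfl fun a _ => ?_
  simp only [actionValue, stopProb, G.totalProb_eq_one h i, mul_one, mul_add,
    Finset.sum_add_distrib, ← Finset.sum_mul]
  ring

/-! ### Single-state deviations of a single player -/

/-- The part of a displacement `d` that concerns player `i` at the state `s` only. -/
def block (d : Profile I S A) (i : I) (s : S) : Profile I S A :=
  WithLp.toLp 2 fun k => if k.1 = i ∧ k.2.1 = s then d k else 0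

omit [∀ i, Fintype (A i)] [Fintype I] [Fintype S] in
lemma block_apply (d : Profile I S A) (i : I) (s : S) (k : Σ i : I, S × A i) :
    block d i s k = if k.1 = i ∧ k.2.1 = s then d k else 0 := rfl

omit [∀ i, Fintype (A i)] in
lemma sum_block (d : Profile I S A) : ∑ i, ∑ s, block d i s = d := by
  ext k
  simp only [WithLp.ofLp_sum, Finset.sum_apply, block_apply]
  rw [Finset.sum_eq_single k.1 (fun i _ hi => Finset.sum_eq_zero fun s _ => by simp [hi.symm])
    (by simp), Finset.sum_eq_single k.2.1 (fun s _ hs => by simp [hs.symm]) (by simp)]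
  simp

/-- Along a displacement of player `i` alone, the gradient field is the derivative of the value
of player `i`. -/
lemma inner_gradField_block (G : StochasticGame I S A) (x d : Profile I S A) (i : I) (s : S) :
    inner ℝ (G.gradField x) (block d i s) = fderiv ℝ (G.value i) x (block d i s) := by
  have h : fderiv ℝ (G.value i) x (block d i s) =
      inner ℝ (gradient (G.value i) x) (block d i s) := by
    rw [gradient, InnerProductSpace.toDual_symm_apply]
  rw [h, PiLp.inner_apply, PiLp.inner_apply]
  refine Finset.sum_congr rfl fun k _ => ?_
  rw [block_apply]
  by_cases hk : k.1 = i ∧ k.2.1 = s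
  · have : G.gradField x k = gradient (G.value i) x k := by
      rw [← hk.1]
      rfl
    rw [this]
  · simp [hk]

omit [Fintype I] [Fintype S] in
lemma add_smul_block_mem {π' π : Profile I S A} (h' : π' ∈ policies I S A)
    (h : π ∈ policies I S A) (i : I) (s : S) {t : ℝ} (h0 : 0 ≤ t) (h1 : t ≤ 1) :
    π' + t • block (π - π') i s ∈ policies I S A := by
  intro j s'
  by_cases hk : j = i ∧ s' = s
  · have hc : ∀ a, (π' + t • block (π - π') i s) ⟨j, s', a⟩ =
        (1 - t) * π' ⟨j, s', a⟩ + t * π ⟨j, s', a⟩ := by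
      intro a
      simp only [PiLp.add_apply, PiLp.smul_apply, block_apply, hk, and_self, if_true,
        PiLp.sub_apply, smul_eq_mul]
      ring
    simp only [hc]
    constructor
    · intro a
      have := (h' j s').1 a
      have := (h j s').1 a
      have : 0 ≤ 1 - t := by linarith
      positivity
    · rw [Finset.sum_add_distrib, ← Finset.mul_sum, ← Finset.mul_sum, (h' j s').2, (h j s').2]
      ring
  · have hc : ∀ a, (π' + t • block (π - π') i s) ⟨j, s', a⟩ = π' ⟨j, s', a⟩ := by
      intro a
      simp only [PiLp.add_apply, PiLp.smul_apply, block_apply, hk, if_false, smul_eq_mul,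
        mul_zero, add_zero]
    simp only [hc]
    exact h' j s'

lemma hasDerivAt_value_line (G : StochasticGame I S A) (i : I) {π' b : Profile I S A} {t : ℝ}
    (h : π' + t • b ∈ G.domain) :
    HasDerivAt (fun t : ℝ => G.value i (π' + t • b)) (fderiv ℝ (G.value i) (π' + t • b) b) t := by
  have h1 : HasDerivAt (fun t : ℝ => π' + t • b) b t := by
    simpa using ((hasDerivAt_id t).smul_const b).const_add π'
  exact (((G.contDiffAt_value i h (n := 1)).differentiableAt (by norm_num)).hasFDerivAt)
    |>.comp_hasDerivAt t h1

lemma IsNash.inner_block_nonpos {G : StochasticGame I S A} {π' π : Profile I S A}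
    (hN : G.IsNash π') (h : π ∈ policies I S A) (i : I) (s : S) :
    inner ℝ (G.gradField π') (block (π - π') i s) ≤ 0 := by
  rw [inner_gradField_block]
  set b := block (π - π') i s with hb
  have hmax : IsLocalMaxOn (G.value i) (segment ℝ π' (π' + b)) π' := by
    refine IsMaxOn.localize fun x hx => ?_
    rw [segment_eq_image'] at hx
    obtain ⟨t, ht, rfl⟩ := hx
    simp only [add_sub_cancel_left]
    refine hN.2 i _ (add_smul_block_mem hN.1 h i s ht.1 ht.2) fun j hj s' a => ?_
    simp [hb, block_apply, hj]
  exact hmax.hasFDerivWithinAt_nonpos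
    (((G.contDiffAt_value i (G.policies_subset_domain hN.1) (n := 1)).differentiableAt
      (by norm_num)).hasFDerivAt.hasFDerivWithinAt)
    (mem_posTangentConeAt_of_segment_subset subset_rfl)

lemma IsNash.inner_gradField_nonpos {G : StochasticGame I S A} {π' π : Profile I S A}
    (hN : G.IsNash π') (h : π ∈ policies I S A) :
    inner ℝ (G.gradField π') (π - π') ≤ 0 := by
  rw [← sum_block (π - π')]
  simp only [inner_sum]
  exact Finset.sum_nonpos fun i _ => Finset.sum_nonpos fun s _ => hN.inner_block_nonpos h i s

/-- The performance difference identity for two policies, in terms of the transition matrix of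
the first and the action values of the second. -/
lemma one_sub_mulVec_valueFrom_sub (G : StochasticGame I S A) {x y : Profile I S A}
    (hx : x ∈ policies I S A) (hy : y ∈ policies I S A) (i : I) (s : S) :
    (1 - G.transMatrix x).mulVec (fun s => G.valueFrom i s y - G.valueFrom i s x) s =
      ∑ a, (weight y s a - weight x s a) * G.actionValue i y s a := by
  rw [one_sub_mulVec, G.valueFrom_eq_sum_actionValue hx, G.valueFrom_eq_sum_actionValue hy]
  have : ∀ a, ∑ s', G.trans s a s' * (G.valueFrom i s' y - G.valueFrom i s' x) =
      G.actionValue i y s a - G.actionValue i x s a := by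
    intro a
    simp only [actionValue, mul_sub, Finset.sum_sub_distrib]
    ring
  simp only [this]
  simp only [mul_sub, sub_mul, Finset.sum_sub_distrib]
  ring

/-- The derivative of the weight of an action profile when player `i` moves along `b`. -/
def weightDeriv (π' b : Profile I S A) (i : I) (s : S) (a : ∀ i, A i) : ℝ :=
  b ⟨i, s, a i⟩ * ∏ j ∈ Finset.univ.erase i, π' ⟨j, s, a j⟩

omit [Fintype S] [∀ i, Fintype (A i)] in
lemma weight_add_smul_block (π' d : Profile I S A) (i : I) (s s' : S) (t : ℝ) (a : ∀ i, A i) :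
    weight (π' + t • block d i s) s' a - weight π' s' a =
      if s' = s then t * weightDeriv π' (block d i s) i s a else 0 := by
  by_cases hs : s' = s
  · subst hs
    simp only [weight, weightDeriv, if_true]
    rw [← Finset.mul_prod_erase _ _ (Finset.mem_univ i),
      ← Finset.mul_prod_erase _ (fun j => π' ⟨j, s', a j⟩) (Finset.mem_univ i)]
    have : ∏ j ∈ Finset.univ.erase i, (π' + t • block d i s') ⟨j, s', a j⟩ =
        ∏ j ∈ Finset.univ.erase i, π' ⟨j, s', a j⟩ := by
      refine Finset.prod_congr rfl fun j hj => ?_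
      simp [block_apply, Finset.ne_of_mem_erase hj]
    rw [this]
    simp only [PiLp.add_apply, PiLp.smul_apply, smul_eq_mul]
    ring
  · simp only [weight, hs, if_false, sub_eq_zero]
    refine Finset.prod_congr rfl fun j _ => ?_
    simp [block_apply, hs]

/-- If the value of player `i` has zero derivative at `π'` along a deviation at a single state,
then it is constant along that deviation. Indeed the value is a linear fractional function of the
parameter: the performance difference is the product of the parameter, of an expected advantage,
and of an expected number of visits which does not depend on the parameter. -/
lemma value_line_eq_of_deriv_eq_zero (G : StochasticGame I S A) {π' π : Profile I S A}
    (h' : π' ∈ policies I S A) (h : π ∈ policies I S A) (i : I) (s : S)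
    (h0 : fderiv ℝ (G.value i) π' (block (π - π') i s) = 0) {t : ℝ} (ht0 : 0 ≤ t) (ht1 : t ≤ 1) :
    G.value i (π' + t • block (π - π') i s) = G.value i π' := by
  set b := block (π - π') i s with hb
  set c : (∀ i, A i) → ℝ := weightDeriv π' b i s with hc
  set adv : ℝ → ℝ := fun t => ∑ a, c a * G.actionValue i (π' + t • b) s a with hadv
  have hmem : ∀ t : ℝ, 0 ≤ t → t ≤ 1 → π' + t • b ∈ policies I S A := fun t h0 h1 =>
    add_smul_block_mem h' h i s h0 h1
  have hdet := G.det_one_sub_ne_zero (G.policies_subset_domain h')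
  -- `vis` is the expected number of visits to `s` under `π'`
  set u := (1 - G.transMatrix π')⁻¹.mulVec (Pi.single s 1) with hu
  set vis : ℝ := ∑ s, G.init s * u s with hvis
  have hdiff : ∀ t : ℝ, 0 ≤ t → t ≤ 1 →
      G.value i (π' + t • b) - G.value i π' = t * adv t * vis := by
    intro t h0 h1
    have h2 : (1 - G.transMatrix π').mulVec
        (fun s => G.valueFrom i s (π' + t • b) - G.valueFrom i s π') =
        (t * adv t) • Pi.single s 1 := by
      ext s'
      rw [G.one_sub_mulVec_valueFrom_sub h' (hmem t h0 h1)]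
      simp only [hb, weight_add_smul_block]
      by_cases hs : s' = s
      · subst hs
        simp only [if_true, Pi.smul_apply, Pi.single_eq_same, smul_eq_mul, mul_one, hadv,
          Finset.mul_sum, mul_assoc, hc, hb]
      · simp [hs]
    have h3 : (fun s => G.valueFrom i s (π' + t • b) - G.valueFrom i s π') =
        (t * adv t) • u := by
      have h4 := congrArg (fun v => (1 - G.transMatrix π')⁻¹.mulVec v) h2
      simpa only [Matrix.mulVec_mulVec, Matrix.nonsing_inv_mul _ (isUnit_iff_ne_zero.2 hdet),
        Matrix.one_mulVec, Matrix.mulVec_smul] using h4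
    simp only [value, ← Finset.sum_sub_distrib, ← mul_sub]
    rw [hvis, Finset.mul_sum]
    refine Finset.sum_congr rfl fun s' _ => ?_
    have := congrFun h3 s'
    simp only [Pi.smul_apply, smul_eq_mul] at this
    rw [this]
    ring
  by_cases hA : adv 0 = 0
  · have h2 : (1 - G.transMatrix (π' + t • b)).mulVec
        (fun s => G.valueFrom i s π' - G.valueFrom i s (π' + t • b)) = 0 := by
      ext s'
      rw [G.one_sub_mulVec_valueFrom_sub (hmem t ht0 ht1) h']
      have h3 : ∀ a, weight π' s' a - weight (π' + t • b) s' a =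
          -(if s' = s then t * c a else 0) := fun a => by
        rw [hc, hb, ← weight_add_smul_block]
        ring
      simp only [h3]
      by_cases hs : s' = s
      · subst hs
        have h5 : ∑ a, c a * G.actionValue i π' s' a = 0 := by simpa [hadv] using hA
        simp only [if_true, neg_mul, Finset.sum_neg_distrib, mul_assoc, ← Finset.mul_sum, h5]
        simp
      · simp [hs]
    have h3 := Matrix.eq_zero_of_mulVec_eq_zero
      (G.det_one_sub_ne_zero (G.policies_subset_domain (hmem t ht0 ht1))) h2
    simp only [value]
    refine Finset.sum_congr rfl fun s' _ => ?_
    have := congrFun h3 s'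
    simp only [Pi.zero_apply, sub_eq_zero] at this
    rw [this]
  · have hd : HasDerivAt (fun t : ℝ => G.value i (π' + t • b)) 0 0 := by
      have := G.hasDerivAt_value_line i (π' := π') (b := b) (t := 0)
        (by simpa using G.policies_subset_domain h')
      rw [zero_smul, add_zero, h0] at this
      exact this
    have hlim : Tendsto (fun t => adv t * vis) (𝓝[>] (0 : ℝ)) (𝓝 0) := by
      have h1 := (hasDerivAt_iff_tendsto_slope_zero.1 hd).mono_left
        (nhdsWithin_mono 0 fun x (hx : 0 < x) => ne_of_gt hx)
      refine h1.congr' ?_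
      filter_upwards [Ioc_mem_nhdsGT (zero_lt_one (α := ℝ))] with t ht
      simp only [zero_add, zero_smul, add_zero, smul_eq_mul]
      rw [hdiff t ht.1.le ht.2]
      field_simp [ht.1.ne']
    have hcont : ContinuousAt adv 0 := by
      have hW : ∀ s', ContinuousAt (fun t : ℝ => G.valueFrom i s' (π' + t • b)) 0 := by
        intro s'
        have h1 : ContinuousAt (fun y => G.valueFrom i s' y) (π' + (0 : ℝ) • b) := by
          rw [zero_smul, add_zero]
          exact (G.contDiffAt_valueFrom i (G.policies_subset_domain h') (n := 0) s').continuousAt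
        exact h1.comp (f := fun t : ℝ => π' + t • b) (by fun_prop)
      simp only [hadv, actionValue]
      fun_prop
    have h2 := tendsto_nhds_unique hlim ((hcont.tendsto.mono_left nhdsWithin_le_nhds).mul_const vis)
    have hv : vis = 0 := (mul_eq_zero.1 h2.symm).resolve_left hA
    have := hdiff t ht0 ht1
    rw [hv, mul_zero, sub_eq_zero] at this
    exact this

omit [DecidableEq I] [DecidableEq S] in
lemma tendsto_line_nhdsWithin {π' b : Profile I S A}
    (hmem : ∀ t : ℝ, 0 ≤ t → t ≤ 1 → π' + t • b ∈ policies I S A) :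
    Tendsto (fun t : ℝ => π' + t • b) (𝓝[>] 0) (𝓝[policies I S A] π') := by
  refine tendsto_nhdsWithin_iff.2 ⟨?_, ?_⟩
  · have : Tendsto (fun t : ℝ => π' + t • b) (𝓝 0) (𝓝 (π' + (0 : ℝ) • b)) :=
      Continuous.tendsto (by fun_prop) 0
    rw [zero_smul, add_zero] at this
    exact this.mono_left nhdsWithin_le_nhds
  · filter_upwards [Ioc_mem_nhdsGT (zero_lt_one (α := ℝ))] with t ht
    exact hmem t ht.1.le ht.2

/-- Under the quadratic bound, every single-state deviation of a single player is strictly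
unprofitable to first order; otherwise the value of that player would be constant along it. -/
lemma IsNash.inner_block_neg {G : StochasticGame I S A} {π' π : Profile I S A}
    (hN : G.IsNash π') {μ : ℝ} (hμ : 0 < μ) {B : Set (Profile I S A)}
    (hB : B ∈ 𝓝[policies I S A] π') (hQ : G.QuadraticBoundOn π' μ B) (h : π ∈ policies I S A)
    (i : I) (s : S) (hb : block (π - π') i s ≠ 0) :
    inner ℝ (G.gradField π') (block (π - π') i s) < 0 := by
  refine lt_of_le_of_ne (hN.inner_block_nonpos h i s) fun h0 => ?_
  rw [inner_gradField_block] at h0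
  have hmem : ∀ t : ℝ, 0 ≤ t → t ≤ 1 → π' + t • block (π - π') i s ∈ policies I S A :=
    fun t h0 h1 => add_smul_block_mem hN.1 h i s h0 h1
  obtain ⟨t, ht, htB⟩ := (Filter.Eventually.and (Ioo_mem_nhdsGT (zero_lt_one (α := ℝ)))
    ((tendsto_line_nhdsWithin hmem).eventually hB)).exists
  have hder := G.hasDerivAt_value_line i (G.policies_subset_domain (hmem t ht.1.le ht.2.le))
  have hconst : HasDerivAt (fun t : ℝ => G.value i (π' + t • block (π - π') i s)) 0 t := by
    refine (hasDerivAt_const t (G.value i π')).congr_of_eventuallyEq ?_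
    filter_upwards [Ioo_mem_nhds ht.1 ht.2] with r hr
    exact G.value_line_eq_of_deriv_eq_zero hN.1 h i s h0 hr.1.le hr.2.le
  have h1 := hQ _ htB
  rw [add_sub_cancel_left, inner_smul_right, inner_gradField_block, hder.unique hconst,
    norm_smul, mul_zero] at h1
  have : 0 < (‖t‖ * ‖block (π - π') i s‖) ^ 2 :=
    pow_pos (mul_pos (norm_pos_iff.2 ht.1.ne') (norm_pos_iff.2 hb)) 2
  nlinarith

lemma IsNash.inner_gradField_neg {G : StochasticGame I S A} {π' π : Profile I S A}
    (hN : G.IsNash π') {μ : ℝ} (hμ : 0 < μ) {B : Set (Profile I S A)}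
    (hB : B ∈ 𝓝[policies I S A] π') (hQ : G.QuadraticBoundOn π' μ B) (h : π ∈ policies I S A)
    (hne : π ≠ π') : inner ℝ (G.gradField π') (π - π') < 0 := by
  have hex : ∃ i s, block (π - π') i s ≠ 0 := by
    by_contra hcon
    push Not at hcon
    have := sum_block (π - π')
    simp only [hcon, Finset.sum_const_zero] at this
    exact hne (sub_eq_zero.1 this.symm)
  obtain ⟨i, s, his⟩ := hex
  rw [← sum_block (π - π')]
  simp only [inner_sum]
  have hle := fun i s => hN.inner_block_nonpos h i s
  exact Finset.sum_neg' (fun j _ => Finset.sum_nonpos fun s _ => hle j s) ⟨i, Finset.mem_univ _,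
    Finset.sum_neg' (fun s _ => hle i s) ⟨s, Finset.mem_univ _,
      hN.inner_block_neg hμ hB hQ h i s his⟩⟩

/-! ### Uniform bounds from compactness of the tangent directions -/

omit [DecidableEq I] [DecidableEq S] in
/-- The tangent cone of the polytope of policies at `π'` is closed, and all its rays meet the
polytope; hence a function that is negative along feasible displacements, however rescaled, is
bounded away from zero on feasible unit directions. -/
lemma exists_le_neg_of_feasible {π' : Profile I S A} (h' : π' ∈ policies I S A)
    {f : Profile I S A → ℝ} (hf : Continuous f)
    (hneg : ∀ π ∈ policies I S A, π ≠ π' → ∀ r : ℝ, 0 < r → f (r • (π - π')) < 0) :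
    ∃ c : ℝ, 0 < c ∧ ∀ π ∈ policies I S A, π ≠ π' → f (‖π - π'‖⁻¹ • (π - π')) ≤ -c := by
  set K : Set (Profile I S A) := {d | (∀ i s, ∑ a, d ⟨i, s, a⟩ = 0) ∧ ∀ k, π' k = 0 → 0 ≤ d k} ∩
    Metric.sphere 0 1 with hK
  have hKc : IsCompact K := by
    refine (isCompact_sphere _ _).inter_left ?_
    simp only [Set.ofPred_and, Set.ofPred_forall]
    refine (isClosed_iInter fun i => isClosed_iInter fun s => ?_).inter
      (isClosed_iInter fun k => isClosed_iInter fun _ => ?_)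
    · exact isClosed_eq (by fun_prop) continuous_const
    · exact isClosed_le continuous_const (by fun_prop)
  have hmem : ∀ π ∈ policies I S A, π ≠ π' → ‖π - π'‖⁻¹ • (π - π') ∈ K := by
    intro π h hne
    refine ⟨⟨fun i s => ?_, fun k hk => ?_⟩, ?_⟩
    · simp only [PiLp.smul_apply, PiLp.sub_apply, smul_eq_mul, ← Finset.mul_sum,
        Finset.sum_sub_distrib, (h i s).2, (h' i s).2, sub_self, mul_zero]
    · simp only [PiLp.smul_apply, PiLp.sub_apply, smul_eq_mul, hk, sub_zero]
      exact mul_nonneg (by positivity) ((h k.1 k.2.1).1 k.2.2)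
    · rw [mem_sphere_zero_iff_norm, norm_smul, norm_inv, norm_norm,
        inv_mul_cancel₀ (norm_ne_zero_iff.2 (sub_ne_zero.2 hne))]
  have hpos : ∀ d ∈ K, f d < 0 := by
    rintro d ⟨⟨hd1, hd2⟩, hd3⟩
    have hev : ∀ᶠ t in 𝓝[>] (0 : ℝ), π' + t • d ∈ policies I S A := by
      have h1 : ∀ᶠ t in 𝓝[>] (0 : ℝ), ∀ k, 0 ≤ (π' + t • d) k := by
        refine eventually_all.2 fun k => ?_
        rcases ((h' k.1 k.2.1).1 k.2.2).eq_or_lt with hk | hk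
        · filter_upwards [self_mem_nhdsWithin] with t ht
          have hk' : π' k = 0 := hk.symm
          simp only [PiLp.add_apply, PiLp.smul_apply, hk', zero_add, smul_eq_mul]
          exact mul_nonneg (le_of_lt ht) (hd2 k hk')
        · have hc : Tendsto (fun t : ℝ => (π' + t • d) k) (𝓝[>] 0) (𝓝 (π' k)) := by
            have : Tendsto (fun t : ℝ => (π' + t • d) k) (𝓝 0) (𝓝 ((π' + (0 : ℝ) • d) k)) :=
              Continuous.tendsto (by fun_prop) 0
            rw [zero_smul, add_zero] at this
            exact this.mono_left nhdsWithin_le_nhds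
          exact (hc.eventually (lt_mem_nhds hk)).mono fun t ht => ht.le
      filter_upwards [h1] with t ht i s
      refine ⟨fun a => ht _, ?_⟩
      simp only [PiLp.add_apply, PiLp.smul_apply, smul_eq_mul, Finset.sum_add_distrib,
        ← Finset.mul_sum, hd1, (h' i s).2, mul_zero, add_zero]
    obtain ⟨t, ht, ht0⟩ := (hev.and self_mem_nhdsWithin).exists
    have ht0 : 0 < t := ht0
    have hd0 : d ≠ 0 := by
      rintro rfl
      simp at hd3
    have := hneg _ ht (by simpa [ht0.ne'] using hd0) t⁻¹ (inv_pos.2 ht0)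
    rwa [add_sub_cancel_left, smul_smul, inv_mul_cancel₀ ht0.ne', one_smul] at this
  rcases K.eq_empty_or_nonempty with he | hne
  · exact ⟨1, one_pos, fun π h hne => absurd (hmem π h hne) (by simp [he])⟩
  · obtain ⟨d, hd, hmax⟩ := hKc.exists_isMaxOn hne hf.continuousOn
    refine ⟨-f d, neg_pos.2 (hpos d hd), fun π h hne => ?_⟩
    rw [neg_neg]
    exact hmax (hmem π h hne)

/-- Near `π'`, the quadratic bound holds with twice the constant: the drift towards `π'` is in
fact linear in the distance. -/
lemma IsNash.exists_improved_bound {G : StochasticGame I S A} {π' : Profile I S A}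
    (hN : G.IsNash π') {μ : ℝ} (hμ : 0 < μ) {B : Set (Profile I S A)}
    (hB : B ∈ 𝓝[policies I S A] π') (hQ : G.QuadraticBoundOn π' μ B) :
    ∃ r : ℝ, 0 < r ∧ ∀ π ∈ policies I S A, ‖π - π'‖ ^ 2 ≤ r →
      inner ℝ (G.gradField π) (π - π') ≤ -(2 * μ) * ‖π - π'‖ ^ 2 := by
  obtain ⟨c, hc, hlin⟩ := exists_le_neg_of_feasible hN.1
    (f := fun d => inner ℝ (G.gradField π') d) (by fun_prop) fun π h hne r hr => by
      rw [inner_smul_right]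
      exact mul_neg_of_pos_of_neg hr (hN.inner_gradField_neg hμ hB hQ h hne)
  have hcont := (G.differentiableAt_gradField (G.policies_subset_domain hN.1)).continuousAt
  obtain ⟨ε, hε, hball⟩ := Metric.continuousAt_iff.1 hcont (c / 2) (by positivity)
  set ρ := min (ε / 2) (c / (4 * μ)) with hρ
  have hρ0 : 0 < ρ := lt_min (by positivity) (by positivity)
  refine ⟨ρ ^ 2, by positivity, fun π h hr => ?_⟩
  rcases eq_or_ne π π' with rfl | hne
  · simp
  have hd : ‖π - π'‖ ≤ ρ := le_of_sq_le_sq hr hρ0.le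
  have hd0 : 0 < ‖π - π'‖ := norm_pos_iff.2 (sub_ne_zero.2 hne)
  have h1 : ‖G.gradField π - G.gradField π'‖ ≤ c / 2 := by
    rw [← dist_eq_norm]
    refine (hball ?_).le
    rw [dist_eq_norm]
    linarith [min_le_left (ε / 2) (c / (4 * μ))]
  have h2 := hlin π h hne
  simp only [inner_smul_right] at h2
  rw [inv_mul_le_iff₀ hd0] at h2
  have h3 : inner ℝ (G.gradField π - G.gradField π') (π - π') ≤ c / 2 * ‖π - π'‖ :=
    (real_inner_le_norm _ _).trans (mul_le_mul_of_nonneg_right h1 hd0.le)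
  rw [inner_sub_left] at h3
  have h4 : ‖π - π'‖ * (4 * μ) ≤ c := by
    rw [← le_div_iff₀ (by positivity)]
    exact hd.trans (min_le_right _ _)
  nlinarith

omit [Fintype I] [DecidableEq I] [Fintype S] [DecidableEq S] in
lemma isClosed_policies : IsClosed (policies I S A) := by
  simp only [policies, Set.ofPred_and, Set.ofPred_forall]
  refine isClosed_iInter fun i => isClosed_iInter fun s => IsClosed.inter
    (isClosed_iInter fun a => isClosed_le continuous_const (by fun_prop))
    (isClosed_eq (by fun_prop) continuous_const)

/-- The Taylor expansion of the gradient field at a second-order stationary policy. -/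
lemma IsSecondOrderStationary.exists_quadraticBoundOn {G : StochasticGame I S A}
    {π' : Profile I S A} (h : G.IsSecondOrderStationary π') :
    ∃ μ : ℝ, 0 < μ ∧ ∃ B ∈ 𝓝[policies I S A] π',
      B ⊆ policies I S A ∧ MeasurableSet B ∧ G.QuadraticBoundOn π' μ B := by
  obtain ⟨hN, hsos⟩ := h
  set J := fderiv ℝ G.gradField π' with hJ
  obtain ⟨c, hc, hquad⟩ := exists_le_neg_of_feasible hN.1
    (f := fun d => inner ℝ d (J d)) (by fun_prop) fun π h hne r hr => by
      rw [map_smul, inner_smul_left, inner_smul_right]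
      have := hsos π h hne
      simp only [conj_trivial]
      exact mul_neg_of_pos_of_neg hr (mul_neg_of_pos_of_neg hr this)
  have hJd := (G.differentiableAt_gradField (G.policies_subset_domain hN.1)).hasFDerivAt
  rw [hasFDerivAt_iff_isLittleO, isLittleO_iff] at hJd
  obtain ⟨ε, hε, hball⟩ := Metric.eventually_nhds_iff_ball.1 (hJd (half_pos hc))
  refine ⟨c / 2, by positivity, policies I S A ∩ Metric.ball π' ε,
    inter_mem_nhdsWithin _ (Metric.ball_mem_nhds _ hε), Set.inter_subset_left,
    isClosed_policies.measurableSet.inter Metric.isOpen_ball.measurableSet, ?_⟩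
  rintro π ⟨hπ, hπε⟩
  rcases eq_or_ne π π' with rfl | hne
  · simp
  have hd0 : 0 < ‖π - π'‖ := norm_pos_iff.2 (sub_ne_zero.2 hne)
  have h1 := hball π hπε
  have h2 := hquad π hπ hne
  simp only [map_smul, inner_smul_left, inner_smul_right, conj_trivial] at h2
  rw [inv_mul_le_iff₀ hd0, inv_mul_le_iff₀ hd0] at h2
  have h3 : inner ℝ (G.gradField π - G.gradField π' - J (π - π')) (π - π') ≤
      c / 2 * ‖π - π'‖ * ‖π - π'‖ :=
    (real_inner_le_norm _ _).trans (mul_le_mul_of_nonneg_right h1 hd0.le)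
  rw [inner_sub_left, inner_sub_left, real_inner_comm (π - π') (J (π - π'))] at h3
  have h4 := hN.inner_gradField_nonpos hπ
  nlinarith

/-! ### Step sizes and a recursive inequality of Chung -/

lemma stepSize_pos {γ m p : ℝ} (hγ : 0 < γ) (hm : 0 ≤ m) {n : ℕ} (hn : 1 ≤ n) :
    0 < stepSize γ m p n := by
  have : (1 : ℝ) ≤ n := by exact_mod_cast hn
  unfold stepSize
  positivity

lemma stepSize_le {γ m p : ℝ} (hγ : 0 < γ) (hp : 0 ≤ p) (hm : 0 ≤ m) {n : ℕ} (hn : 1 ≤ n) :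
    stepSize γ m p n ≤ stepSize γ 0 p n := by
  have : (1 : ℝ) ≤ n := by exact_mod_cast hn
  unfold stepSize
  refine div_le_div_of_nonneg_left hγ.le (by positivity) ?_
  exact Real.rpow_le_rpow (by positivity) (by linarith) hp

lemma stepSize_zero_eq {γ p : ℝ} {n : ℕ} : stepSize γ 0 p n = γ * (n : ℝ) ^ (-p) := by
  rw [stepSize, add_zero, Real.rpow_neg (Nat.cast_nonneg n), div_eq_mul_inv]

/-- The size of the error, up to a constant, that bias and noise cause in one step. -/
def errTerm (γ m p : ℝ) (bb sd : ℕ → ℝ) (n : ℕ) : ℝ :=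
  stepSize γ m p n * |bb n| + stepSize γ m p n ^ 2 * (1 + bb n ^ 2 + sd n ^ 2)

lemma errTerm_nonneg {γ m p : ℝ} (hγ : 0 < γ) (hm : 0 ≤ m) (bb sd : ℕ → ℝ) {n : ℕ} (hn : 1 ≤ n) :
    0 ≤ errTerm γ m p bb sd n := by
  have := stepSize_pos (p := p) hγ hm hn
  unfold errTerm
  positivity

lemma errTerm_le {γ m p : ℝ} (hγ : 0 < γ) (hp : 0 ≤ p) (hm : 0 ≤ m) (bb sd : ℕ → ℝ) {n : ℕ}
    (hn : 1 ≤ n) : errTerm γ m p bb sd n ≤ errTerm γ 0 p bb sd n := by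
  have h1 := stepSize_pos (p := p) hγ hm hn
  have h2 := stepSize_le hγ hp hm hn
  unfold errTerm
  gcongr

lemma isBigO_errTerm {γ m p lb ls : ℝ} {bb sd : ℕ → ℝ} (hγ : 0 < γ) (hm : 0 ≤ m) (hp : 1 / 2 < p)
    (hls : 0 ≤ ls) (hlb : 0 ≤ lb) (hbb : bb =O[atTop] (fun n : ℕ => (n : ℝ) ^ (-lb)))
    (hsd : sd =O[atTop] (fun n : ℕ => (n : ℝ) ^ ls)) :
    errTerm γ m p bb sd =O[atTop] fun n : ℕ => (n : ℝ) ^ (-(p + min lb (p - 2 * ls))) := by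
  have hcmp : ∀ {a b : ℝ}, a ≤ b →
      (fun n : ℕ => (n : ℝ) ^ a) =O[atTop] fun n : ℕ => (n : ℝ) ^ b := fun {a b} hab => by
    refine IsBigO.of_bound 1 ?_
    filter_upwards [eventually_ge_atTop 1] with n hn
    have hn1 : (1 : ℝ) ≤ n := by exact_mod_cast hn
    rw [one_mul, Real.norm_of_nonneg (by positivity), Real.norm_of_nonneg (by positivity)]
    exact Real.rpow_le_rpow_of_exponent_le hn1 hab
  have hmul : ∀ {f g : ℕ → ℝ} {a b c : ℝ}, f =O[atTop] (fun n : ℕ => (n : ℝ) ^ a) →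
      g =O[atTop] (fun n : ℕ => (n : ℝ) ^ b) → a + b ≤ c →
      (fun n => f n * g n) =O[atTop] fun n : ℕ => (n : ℝ) ^ c := fun {f g a b c} hf hg hab => by
    refine ((hf.mul hg).congr' (EventuallyEq.refl _ _) ?_).trans (hcmp hab)
    filter_upwards [eventually_ge_atTop 1] with n hn
    have hn1 : (0 : ℝ) < n := by exact_mod_cast hn
    rw [Real.rpow_add hn1]
  have h0 : errTerm γ m p bb sd =O[atTop] errTerm γ 0 p bb sd := by
    refine IsBigO.of_bound 1 ?_
    filter_upwards [eventually_ge_atTop 1] with n hn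
    rw [one_mul, Real.norm_of_nonneg (errTerm_nonneg hγ hm _ _ hn),
      Real.norm_of_nonneg (errTerm_nonneg hγ le_rfl _ _ hn)]
    exact errTerm_le hγ (by linarith) hm _ _ hn
  have hs : (fun n => stepSize γ 0 p n) =O[atTop] fun n : ℕ => (n : ℝ) ^ (-p) := by
    simp only [stepSize_zero_eq]
    exact (isBigO_refl _ _).const_mul_left γ
  have hone : (fun _ : ℕ => (1 : ℝ)) =O[atTop] fun n : ℕ => (n : ℝ) ^ (2 * ls) := by
    simpa using hcmp (a := 0) (b := 2 * ls) (by linarith)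
  have hb2 : (fun n => bb n ^ 2) =O[atTop] fun n : ℕ => (n : ℝ) ^ (2 * ls) := by
    simp only [pow_two]
    exact hmul hbb hbb (by linarith)
  have hs2 : (fun n => sd n ^ 2) =O[atTop] fun n : ℕ => (n : ℝ) ^ (2 * ls) := by
    simp only [pow_two]
    exact hmul hsd hsd (by linarith)
  have hq1 := min_le_left lb (p - 2 * ls)
  have hq2 := min_le_right lb (p - 2 * ls)
  refine h0.trans (IsBigO.add (hmul hs hbb.abs_left (by linarith)) ?_)
  simp only [pow_two (stepSize γ 0 p _)]
  exact hmul (hmul hs hs le_rfl) ((hone.add hb2).add hs2) (by linarith)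

lemma summable_errTerm {γ m p lb ls : ℝ} {bb sd : ℕ → ℝ} (hγ : 0 < γ) (hm : 0 ≤ m)
    (hp : 1 / 2 < p) (hls : 0 ≤ ls) (hlb : 0 ≤ lb) (h1 : 1 < p + lb) (h2 : 1 / 2 < p - ls)
    (hbb : bb =O[atTop] (fun n : ℕ => (n : ℝ) ^ (-lb)))
    (hsd : sd =O[atTop] (fun n : ℕ => (n : ℝ) ^ ls)) :
    Summable fun n => errTerm γ m p bb sd (n + 1) := by
  have hq : 1 < p + min lb (p - 2 * ls) := by
    rcases min_choice lb (p - 2 * ls) with h | h <;> rw [h] <;> linarith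
  exact (summable_nat_add_iff 1).2 (summable_of_isBigO_nat
    (Real.summable_nat_rpow.2 (by linarith)) (isBigO_errTerm hγ hm hp hls hlb hbb hsd))

lemma tendsto_tsum_errTerm {γ p lb ls : ℝ} {bb sd : ℕ → ℝ} (hγ : 0 < γ)
    (hp : 1 / 2 < p) (hls : 0 ≤ ls) (hlb : 0 ≤ lb) (h1 : 1 < p + lb) (h2 : 1 / 2 < p - ls)
    (hbb : bb =O[atTop] (fun n : ℕ => (n : ℝ) ^ (-lb)))
    (hsd : sd =O[atTop] (fun n : ℕ => (n : ℝ) ^ ls)) :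
    Tendsto (fun m : ℝ => ∑' n, errTerm γ m p bb sd (n + 1)) atTop (𝓝 0) := by
  rw [← tsum_zero (β := ℕ)]
  refine tendsto_tsum_of_dominated_convergence
    (summable_errTerm hγ le_rfl hp hls hlb h1 h2 hbb hsd) (fun n => ?_) ?_
  · have hs : Tendsto (fun m : ℝ => stepSize γ m p (n + 1)) atTop (𝓝 0) := by
      unfold stepSize
      exact ((tendsto_rpow_atTop (by linarith)).comp
        (tendsto_atTop_add_const_left _ _ tendsto_id)).const_div_atTop γ
    unfold errTerm
    simpa using (hs.mul_const |bb (n + 1)|).add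
      ((hs.pow 2).mul_const (1 + bb (n + 1) ^ 2 + sd (n + 1) ^ 2))
  · filter_upwards [eventually_ge_atTop 0] with m hm n
    rw [Real.norm_of_nonneg (errTerm_nonneg hγ hm _ _ (by omega))]
    exact errTerm_le hγ (by linarith) hm _ _ (by omega)

lemma one_sub_div_mul_rpow_le {q x : ℝ} (hq : 0 ≤ q) (hx : 0 < x) :
    x ^ (-q) * (1 - q / x) ≤ (x + 1) ^ (-q) := by
  have h1 : x + 1 = x * (1 + 1 / x) := by field_simp
  have h2 : 0 < 1 + 1 / x := by positivity
  rw [h1, Real.mul_rpow hx.le h2.le]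
  refine mul_le_mul_of_nonneg_left ?_ (by positivity)
  have h3 : (1 + 1 / x) ^ q ≤ Real.exp (q / x) := by
    calc (1 + 1 / x) ^ q ≤ (Real.exp (1 / x)) ^ q := by
          refine Real.rpow_le_rpow h2.le ?_ hq
          linarith [Real.add_one_le_exp (1 / x)]
      _ = Real.exp (q / x) := by
          rw [← Real.exp_mul]
          congr 1
          ring
  calc 1 - q / x ≤ Real.exp (-(q / x)) := by linarith [Real.add_one_le_exp (-(q / x))]
    _ = (Real.exp (q / x))⁻¹ := Real.exp_neg _
    _ ≤ ((1 + 1 / x) ^ q)⁻¹ := inv_anti₀ (by positivity) h3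
    _ = (1 + 1 / x) ^ (-q) := (Real.rpow_neg h2.le q).symm

lemma rpow_neg_add_isBigO {m q : ℝ} (hm : 0 ≤ m) (hq : 0 ≤ q) :
    (fun n : ℕ => ((n : ℝ) + m) ^ (-q)) =O[atTop] fun n : ℕ => (n : ℝ) ^ (-q) := by
  refine IsBigO.of_bound 1 ?_
  filter_upwards [eventually_ge_atTop 1] with n hn
  have hn1 : (0 : ℝ) < n := by exact_mod_cast hn
  rw [one_mul, Real.norm_of_nonneg (by positivity), Real.norm_of_nonneg (by positivity)]
  exact Real.rpow_le_rpow_of_nonpos hn1 (by linarith) (by linarith)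

lemma rpow_neg_isBigO_add {m q : ℝ} (hm : 0 ≤ m) (hq : 0 ≤ q) :
    (fun n : ℕ => (n : ℝ) ^ (-q)) =O[atTop] fun n : ℕ => ((n : ℝ) + m) ^ (-q) := by
  refine IsBigO.of_bound (2 ^ q) ?_
  filter_upwards [eventually_ge_atTop 1, eventually_ge_atTop ⌈m⌉₊] with n hn hnm
  have hn1 : (0 : ℝ) < n := by exact_mod_cast hn
  have hnm' : m ≤ n := Nat.ceil_le.1 hnm
  rw [Real.norm_of_nonneg (by positivity), Real.norm_of_nonneg (by positivity)]
  have h1 : (2 * (n : ℝ)) ^ (-q) ≤ ((n : ℝ) + m) ^ (-q) :=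
    Real.rpow_le_rpow_of_nonpos (by linarith) (by linarith) (by linarith)
  calc (n : ℝ) ^ (-q) = 2 ^ q * (2 * (n : ℝ)) ^ (-q) := by
        rw [Real.mul_rpow (by norm_num) hn1.le, Real.rpow_neg (by norm_num : (0 : ℝ) ≤ 2),
          ← mul_assoc, mul_inv_cancel₀ (by positivity), one_mul]
    _ ≤ _ := by gcongr

/-- Chung's lemma when the contraction dominates: a recursion with contraction factors
`1 - κ γ_n` and errors of order `n ^ (-(p + q))` decays like `n ^ (-q)`. -/
lemma isBigO_of_recursion {γ m p κ q : ℝ} {e err : ℕ → ℝ} (hγ : 0 < γ) (hm : 0 ≤ m) (hp : 0 < p)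
    (hκ : 0 < κ) (hq : 0 < q) (hpq : p < 1 ∨ p = 1 ∧ q < κ * γ) (he : ∀ n, 0 ≤ e n)
    (hrec : ∀ n, 1 ≤ n → e (n + 1) ≤ (1 - κ * stepSize γ m p n) * e n + err n)
    (herr : err =O[atTop] fun n : ℕ => (n : ℝ) ^ (-(p + q))) :
    e =O[atTop] fun n : ℕ => (n : ℝ) ^ (-q) := by
  refine IsBigO.trans ?_ (rpow_neg_add_isBigO hm hq.le)
  obtain ⟨C, hC, hCerr⟩ := (herr.trans (rpow_neg_isBigO_add hm (by linarith))).exists_pos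
  have hN : Tendsto (fun n : ℕ => (n : ℝ) + m) atTop atTop :=
    tendsto_atTop_add_const_right _ _ tendsto_natCast_atTop_atTop
  -- the room `δ` left by the contraction once the decay of `n ^ (-q)` itself is accounted for
  obtain ⟨δ, hδ, hev⟩ : ∃ δ : ℝ, 0 < δ ∧ ∀ᶠ x : ℝ in atTop, q * x⁻¹ ≤ (κ * γ - δ) * x ^ (-p) := by
    rcases hpq with hp1 | ⟨rfl, hlt⟩
    · refine ⟨κ * γ / 2, by positivity, ?_⟩
      have h1 : Tendsto (fun x : ℝ => q * x ^ (-(1 - p))) atTop (𝓝 (q * 0)) :=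
        (tendsto_rpow_neg_atTop (by linarith)).const_mul q
      rw [mul_zero] at h1
      filter_upwards [h1.eventually (gt_mem_nhds (show 0 < κ * γ / 2 by positivity)),
        eventually_gt_atTop 0] with x hx hx0
      have h2 : x⁻¹ = x ^ (-(1 - p)) * x ^ (-p) := by
        rw [← Real.rpow_add hx0, ← Real.rpow_neg_one]
        congr 1
        ring
      rw [h2, ← mul_assoc]
      refine mul_le_mul_of_nonneg_right ?_ (by positivity)
      linarith
    · refine ⟨κ * γ - q, by linarith, ?_⟩
      filter_upwards [eventually_gt_atTop 0] with x hx
      rw [Real.rpow_neg_one]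
      linarith
  have hsmall : ∀ᶠ n : ℕ in atTop, κ * stepSize γ m p n ≤ 1 := by
    have h1 : Tendsto (fun n : ℕ => κ * stepSize γ m p n) atTop (𝓝 (κ * 0)) := by
      unfold stepSize
      exact (((tendsto_rpow_atTop hp).comp hN).const_div_atTop γ).const_mul κ
    rw [mul_zero] at h1
    exact (h1.eventually (gt_mem_nhds one_pos)).mono fun n hn => hn.le
  obtain ⟨n₀, hn₀⟩ := eventually_atTop.1
    ((hN.eventually hev).and (hsmall.and (hCerr.bound.and (eventually_ge_atTop 1))))
  set K : ℝ := max (C / δ) (e n₀ * ((n₀ : ℝ) + m) ^ q) with hK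
  have hKδ : C ≤ K * δ := by
    rw [← div_le_iff₀ hδ]
    exact le_max_left _ _
  have hK0 : 0 ≤ K := le_trans (by positivity) (le_max_left _ _)
  have hmain : ∀ n, n₀ ≤ n → e n ≤ K * ((n : ℝ) + m) ^ (-q) := by
    intro n hn
    induction n, hn using Nat.le_induction with
    | base =>
      have hx : 0 < (n₀ : ℝ) + m := by
        have : (1 : ℝ) ≤ n₀ := by exact_mod_cast (hn₀ n₀ le_rfl).2.2.2
        linarith
      rw [Real.rpow_neg hx.le, ← div_eq_mul_inv, le_div_iff₀ (by positivity)]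
      exact le_max_right _ _
    | succ n hn ih =>
      obtain ⟨h1, h2, h3, h4⟩ := hn₀ n hn
      have hx : 0 < (n : ℝ) + m := by
        have : (1 : ℝ) ≤ n := by exact_mod_cast h4
        linarith
      set x : ℝ := (n : ℝ) + m with hxdef
      have hstep : stepSize γ m p n = γ * x ^ (-p) := by
        rw [stepSize, Real.rpow_neg hx.le, div_eq_mul_inv]
      have h5 : err n ≤ C * (x ^ (-p) * x ^ (-q)) := by
        rw [← Real.rpow_add hx, ← neg_add]
        refine (le_abs_self _).trans (h3.trans_eq ?_)
        rw [Real.norm_of_nonneg (by positivity)]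
      have h6 := one_sub_div_mul_rpow_le hq.le hx
      have h7 : ((n + 1 : ℕ) : ℝ) + m = x + 1 := by
        push_cast
        ring
      rw [h7]
      have h8 : (1 - κ * stepSize γ m p n) * e n ≤
          (1 - κ * stepSize γ m p n) * (K * x ^ (-q)) :=
        mul_le_mul_of_nonneg_left ih (by linarith)
      have h9 : K * (q * x⁻¹) ≤ K * ((κ * γ - δ) * x ^ (-p)) := mul_le_mul_of_nonneg_left h1 hK0
      have hxp : 0 < x ^ (-p) := by positivity
      have hxq : 0 < x ^ (-q) := by positivity
      have h10 : C * x ^ (-p) ≤ K * δ * x ^ (-p) := mul_le_mul_of_nonneg_right hKδ hxp.le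
      calc e (n + 1) ≤ (1 - κ * stepSize γ m p n) * e n + err n := hrec n h4
        _ ≤ (1 - κ * (γ * x ^ (-p))) * (K * x ^ (-q)) + C * (x ^ (-p) * x ^ (-q)) := by
            rw [hstep] at h8 ⊢
            linarith
        _ = x ^ (-q) * (K - K * (κ * γ) * x ^ (-p) + C * x ^ (-p)) := by ring
        _ ≤ x ^ (-q) * (K - K * (q * x⁻¹)) := by
            refine mul_le_mul_of_nonneg_left ?_ hxq.le
            linarith
        _ = K * (x ^ (-q) * (1 - q / x)) := by ring
        _ ≤ K * (x + 1) ^ (-q) := mul_le_mul_of_nonneg_left h6 hK0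
  refine IsBigO.of_bound K ?_
  filter_upwards [eventually_ge_atTop n₀] with n hn
  rw [Real.norm_of_nonneg (he n), Real.norm_of_nonneg (by positivity)]
  exact hmain n hn

/-- Chung's lemma when the contraction is slow: for steps `γ / (n + m)` and errors of order
`n ^ (-(1 + q))` with `κ γ < q`, the recursion decays like `n ^ (-κ γ)`. -/
lemma isBigO_of_recursion_slow {γ m κ q : ℝ} {e err : ℕ → ℝ} (hγ : 0 < γ) (hm : 0 ≤ m)
    (hκ : 0 < κ) (hq : κ * γ < q) (he : ∀ n, 0 ≤ e n)
    (hrec : ∀ n, 1 ≤ n → e (n + 1) ≤ (1 - κ * stepSize γ m 1 n) * e n + err n)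
    (herr : err =O[atTop] fun n : ℕ => (n : ℝ) ^ (-(1 + q))) :
    e =O[atTop] fun n : ℕ => (n : ℝ) ^ (-(κ * γ)) := by
  set α := κ * γ with hα
  have hα0 : 0 < α := by positivity
  refine IsBigO.trans ?_ (rpow_neg_add_isBigO hm hα0.le)
  obtain ⟨C, hC, hCerr⟩ := (herr.trans (rpow_neg_isBigO_add hm (by linarith))).exists_pos
  obtain ⟨n₀, hn₀⟩ := eventually_atTop.1 (hCerr.bound.and (eventually_ge_atTop 1))
  set g : ℕ → ℝ := fun n => C * 2 ^ α * (n : ℝ) ^ (-(1 + q - α)) with hg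
  have hgs : Summable g := (Real.summable_nat_rpow.2 (by linarith)).mul_left _
  have hg0 : ∀ n, 0 ≤ g n := fun n => by positivity
  set K : ℝ := e n₀ * ((n₀ : ℝ) + m) ^ α + ∑' n, g n with hK
  have hmain : ∀ n, n₀ ≤ n →
      e n * ((n : ℝ) + m) ^ α ≤ e n₀ * ((n₀ : ℝ) + m) ^ α + ∑ k ∈ Finset.range n, g k := by
    intro n hn
    induction n, hn using Nat.le_induction with
    | base => exact le_add_of_nonneg_right (Finset.sum_nonneg fun k _ => hg0 k)
    | succ n hn ih =>
      obtain ⟨h3, h4⟩ := hn₀ n hn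
      have hn1 : (1 : ℝ) ≤ n := by exact_mod_cast h4
      have hx : 1 ≤ (n : ℝ) + m := by linarith
      set x : ℝ := (n : ℝ) + m with hxdef
      have hx0 : 0 < x := by linarith
      have hstep : κ * stepSize γ m 1 n = α / x := by
        rw [stepSize, Real.rpow_one, hα, mul_div_assoc]
      have h7 : ((n + 1 : ℕ) : ℝ) + m = x + 1 := by
        push_cast
        ring
      have h6 := one_sub_div_mul_rpow_le hα0.le hx0
      have h8 : (1 - α / x) * (x + 1) ^ α ≤ x ^ α := by
        rw [Real.rpow_neg hx0.le, Real.rpow_neg (by linarith), ← div_eq_inv_mul,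
          div_le_iff₀ (by positivity), ← div_eq_inv_mul, le_div_iff₀ (by positivity)] at h6
        exact h6
      have h9 : err n * (x + 1) ^ α ≤ g n := by
        have h10 : err n ≤ C * x ^ (-(1 + q)) := by
          refine (le_abs_self _).trans (h3.trans_eq ?_)
          rw [Real.norm_of_nonneg (by positivity)]
        have h11 : (x + 1) ^ α ≤ 2 ^ α * x ^ α := by
          rw [← Real.mul_rpow (by norm_num) hx0.le]
          exact Real.rpow_le_rpow (by linarith) (by linarith) hα0.le
        calc err n * (x + 1) ^ α ≤ C * x ^ (-(1 + q)) * (2 ^ α * x ^ α) :=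
              mul_le_mul h10 h11 (by positivity) (by positivity)
          _ = C * 2 ^ α * x ^ (-(1 + q - α)) := by
              have : x ^ (-(1 + q - α)) = x ^ (-(1 + q)) * x ^ α := by
                rw [← Real.rpow_add hx0]
                congr 1
                ring
              rw [this]
              ring
          _ ≤ g n := by
              refine mul_le_mul_of_nonneg_left ?_ (by positivity)
              exact Real.rpow_le_rpow_of_nonpos (by linarith) (by linarith) (by linarith)
      rw [h7, Finset.sum_range_succ]
      calc e (n + 1) * (x + 1) ^ α ≤ ((1 - α / x) * e n + err n) * (x + 1) ^ α := by
            refine mul_le_mul_of_nonneg_right ?_ (by positivity)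
            rw [← hstep]
            exact hrec n h4
        _ = e n * ((1 - α / x) * (x + 1) ^ α) + err n * (x + 1) ^ α := by ring
        _ ≤ e n * x ^ α + g n := add_le_add (mul_le_mul_of_nonneg_left h8 (he n)) h9
        _ ≤ _ := by linarith
  refine IsBigO.of_bound K ?_
  filter_upwards [eventually_ge_atTop n₀] with n hn
  have hx : 0 < (n : ℝ) + m := by
    have : (1 : ℝ) ≤ n := by exact_mod_cast (hn₀ n hn).2
    linarith
  rw [Real.norm_of_nonneg (he n), Real.norm_of_nonneg (by positivity), Real.rpow_neg hx.le,
    ← div_eq_mul_inv, le_div_iff₀ (by positivity)]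
  exact (hmain n hn).trans (add_le_add_right (hgs.sum_le_tsum _ fun k _ => hg0 k) _)

/-! ### One step of projected policy gradient -/

omit [Fintype I] [DecidableEq I] [Fintype S] [DecidableEq S] in
lemma convex_policies : Convex ℝ (policies I S A) := by
  intro x hx y hy a b ha hb hab i s
  simp only [PiLp.add_apply, PiLp.smul_apply, smul_eq_mul]
  refine ⟨fun k => add_nonneg (mul_nonneg ha ((hx i s).1 k)) (mul_nonneg hb ((hy i s).1 k)), ?_⟩
  rw [Finset.sum_add_distrib, ← Finset.mul_sum, ← Finset.mul_sum, (hx i s).2, (hy i s).2]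
  simpa using hab

omit [DecidableEq I] [DecidableEq S] in
lemma isCompact_policies : IsCompact (policies I S A) := by
  refine Metric.isCompact_of_isClosed_isBounded isClosed_policies ?_
  refine (Metric.isBounded_closedBall (x := (0 : Profile I S A))
    (r := √(Fintype.card (Σ i : I, S × A i)))).subset fun x hx => ?_
  rw [mem_closedBall_zero_iff, EuclideanSpace.norm_eq]
  refine Real.sqrt_le_sqrt ?_
  have h : ∀ k, ‖x k‖ ^ 2 ≤ 1 := fun k => by
    have h0 := (hx k.1 k.2.1).1
    have h1 : x k ≤ 1 := by
      rw [← (hx k.1 k.2.1).2]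
      exact Finset.single_le_sum (f := fun a => x ⟨k.1, k.2.1, a⟩) (fun a _ => h0 a)
        (Finset.mem_univ k.2.2)
    rw [Real.norm_of_nonneg (h0 k.2.2)]
    exact pow_le_one₀ (h0 k.2.2) h1
  calc ∑ k, ‖x k‖ ^ 2 ≤ ∑ _k : (Σ i : I, S × A i), (1 : ℝ) := Finset.sum_le_sum fun k _ => h k
    _ = _ := by simp

omit [DecidableEq I] [DecidableEq S] in
/-- The projection onto the policy space does not increase distances to policies. -/
lemma IsProjection.norm_sub_le {x y z : Profile I S A} (h : IsProjection x y)
    (hz : z ∈ policies I S A) : ‖y - z‖ ≤ ‖x - z‖ := by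
  have : Nonempty (policies I S A) := ⟨⟨y, h.1⟩⟩
  have hinf : ‖x - y‖ = ⨅ w : policies I S A, ‖x - w‖ :=
    le_antisymm (le_ciInf fun w => h.2 w w.2)
      (ciInf_le ⟨0, by rintro _ ⟨w, rfl⟩; exact norm_nonneg _⟩ (⟨y, h.1⟩ : policies I S A))
  have h1 := (norm_eq_iInf_iff_real_inner_le_zero convex_policies h.1).1 hinf z hz
  refine le_of_sq_le_sq ?_ (norm_nonneg _)
  have h2 : x - z = (x - y) - (z - y) := by abel
  rw [norm_sub_rev y z, h2, norm_sub_sq_real (x - y) (z - y)]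
  nlinarith [sq_nonneg ‖x - y‖]

omit [DecidableEq I] [DecidableEq S] in
/-- One step of projected ascent, seen through a function `φ` of the squared distance to `π'`
with nonnegative derivative and a quadratic upper bound. -/
lemma IsProjection.apply_sq_le {π' x y v : Profile I S A} {s R L₁ L₂ : ℝ} {φ φ' : ℝ → ℝ}
    (hs : 0 ≤ s) (h' : π' ∈ policies I S A) (hR : ∀ x ∈ policies I S A, ‖x - π'‖ ≤ R)
    (hφ : ∀ a ∈ Set.Icc 0 (R ^ 2), ∀ b ∈ Set.Icc 0 (R ^ 2),
      φ b ≤ φ a + φ' a * (b - a) + L₂ * (b - a) ^ 2)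
    (hφ' : ∀ a ∈ Set.Icc 0 (R ^ 2), 0 ≤ φ' a ∧ φ' a ≤ L₁) (hL₂ : 0 ≤ L₂)
    (hx : x ∈ policies I S A) (h : IsProjection (x + s • v) y) :
    φ (‖y - π'‖ ^ 2) ≤ φ (‖x - π'‖ ^ 2) +
      2 * s * inner ℝ (φ' (‖x - π'‖ ^ 2) • (x - π')) v +
      s ^ 2 * (L₁ + 4 * R ^ 2 * L₂) * ‖v‖ ^ 2 := by
  have hmem : ∀ z ∈ policies I S A, ‖z - π'‖ ^ 2 ∈ Set.Icc 0 (R ^ 2) := fun z hz =>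
    ⟨by positivity, pow_le_pow_left₀ (norm_nonneg _) (hR z hz) 2⟩
  have h1 := hφ _ (hmem x hx) _ (hmem y h.1)
  obtain ⟨h2, h3⟩ := hφ' _ (hmem x hx)
  -- the increment of the squared distance, bounded above by the unprojected step
  have h4 : ‖y - π'‖ ^ 2 - ‖x - π'‖ ^ 2 ≤ 2 * s * inner ℝ (x - π') v + s ^ 2 * ‖v‖ ^ 2 := by
    have h5 := pow_le_pow_left₀ (norm_nonneg _) (h.norm_sub_le h') 2
    have h6 : x + s • v - π' = (x - π') + s • v := by abel
    rw [h6, norm_add_sq_real, inner_smul_right, norm_smul, mul_pow, Real.norm_eq_abs, sq_abs] at h5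
    linarith
  -- and its absolute value, bounded through nonexpansiveness
  have h7 : (‖y - π'‖ ^ 2 - ‖x - π'‖ ^ 2) ^ 2 ≤ s ^ 2 * (4 * R ^ 2) * ‖v‖ ^ 2 := by
    have h8 : |‖y - π'‖ - ‖x - π'‖| ≤ s * ‖v‖ := by
      refine (abs_norm_sub_norm_le _ _).trans ?_
      rw [sub_sub_sub_cancel_right]
      refine (h.norm_sub_le hx).trans_eq ?_
      rw [add_sub_cancel_left, norm_smul, Real.norm_of_nonneg hs]
    have h9 : |‖y - π'‖ + ‖x - π'‖| ≤ 2 * R := by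
      rw [abs_of_nonneg (by positivity)]
      linarith [hR x hx, hR y h.1]
    have h10 := mul_le_mul h8 h9 (abs_nonneg _) (by positivity)
    rw [← abs_mul] at h10
    calc (‖y - π'‖ ^ 2 - ‖x - π'‖ ^ 2) ^ 2
        = |(‖y - π'‖ - ‖x - π'‖) * (‖y - π'‖ + ‖x - π'‖)| ^ 2 := by
          rw [sq_abs]
          ring
      _ ≤ (s * ‖v‖ * (2 * R)) ^ 2 := pow_le_pow_left₀ (abs_nonneg _) h10 2
      _ = _ := by ring
  rw [inner_smul_left, conj_trivial]
  have h11 := mul_le_mul_of_nonneg_left h4 h2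
  have h12 := mul_le_mul_of_nonneg_left h7 hL₂
  have h13 : φ' (‖x - π'‖ ^ 2) * (s ^ 2 * ‖v‖ ^ 2) ≤ L₁ * (s ^ 2 * ‖v‖ ^ 2) :=
    mul_le_mul_of_nonneg_right h3 (by positivity)
  linarith

lemma measurable_gradField (G : StochasticGame I S A) : Measurable G.gradField := by
  unfold gradField
  refine (WithLp.measurable_toLp 2 _).comp (measurable_pi_lambda _ fun k => ?_)
  have h : Measurable (gradient (G.value k.1)) :=
    (InnerProductSpace.toDual ℝ (Profile I S A)).symm.continuous.measurable.comp
      (measurable_fderiv ℝ (G.value k.1))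
  have h2 : Continuous fun x : Profile I S A => x k := by fun_prop
  exact h2.measurable.comp h

lemma continuousOn_gradField (G : StochasticGame I S A) :
    ContinuousOn G.gradField (policies I S A) := fun _ hx =>
  (G.differentiableAt_gradField (G.policies_subset_domain hx)).continuousAt.continuousWithinAt

section Dynamics

variable {Ω : Type*} [MeasurableSpace Ω] {G : StochasticGame I S A} {P : Measure Ω}
  {γ m p : ℝ} {bb sd : ℕ → ℝ} {π V : ℕ → Ω → Profile I S A}

lemma IsPolicyGradient.mem (h : G.IsPolicyGradient P γ m p bb sd π V) {n : ℕ} (hn : 1 ≤ n)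
    (ω : Ω) : π n ω ∈ policies I S A := by
  rcases hn.eq_or_lt with rfl | hn'
  · exact h.init_mem ω
  · obtain ⟨k, rfl⟩ := Nat.exists_eq_succ_of_ne_zero (by omega : n ≠ 0)
    exact (h.update k (by omega) ω).1

lemma IsPolicyGradient.history_le (h : G.IsPolicyGradient P γ m p bb sd π V) (n : ℕ) :
    history π n ≤ ‹MeasurableSpace Ω› :=
  iSup₂_le fun k hk => (h.measurable k (Finset.mem_Icc.1 hk).1).comap_le

omit [Fintype I] [DecidableEq I] [Fintype S] [DecidableEq S] [∀ i, Fintype (A i)]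
  [MeasurableSpace Ω] in
lemma measurable_history (π : ℕ → Ω → Profile I S A) {k n : ℕ} (hk : 1 ≤ k) (hkn : k ≤ n) :
    Measurable[history π n] (π k) := by
  rw [measurable_iff_comap_le]
  exact le_iSup₂_of_le (f := fun k (_ : k ∈ Finset.Icc 1 n) =>
    MeasurableSpace.comap (π k) inferInstance) k (Finset.mem_Icc.2 ⟨hk, hkn⟩) le_rfl

omit [Fintype I] [DecidableEq I] [Fintype S] [DecidableEq S] [∀ i, Fintype (A i)]
  [MeasurableSpace Ω] in
lemma history_mono (π : ℕ → Ω → Profile I S A) : Monotone (history π) := fun _ _ hij =>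
  biSup_mono fun _ hk =>
    Finset.mem_Icc.2 ⟨(Finset.mem_Icc.1 hk).1, (Finset.mem_Icc.1 hk).2.trans hij⟩

lemma IsPolicyGradient.integrable_comp [IsFiniteMeasure P] {E : Type*} [NormedAddCommGroup E]
    [MeasurableSpace E] [BorelSpace E] [SecondCountableTopology E]
    (h : G.IsPolicyGradient P γ m p bb sd π V) {f : Profile I S A → E} (hf : Measurable f)
    (hfc : ContinuousOn f (policies I S A)) {n : ℕ} (hn : 1 ≤ n) :
    Integrable (fun ω => f (π n ω)) P := by
  obtain ⟨c, hc⟩ := isCompact_policies.exists_bound_of_continuousOn hfc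
  exact Integrable.of_bound (hf.comp (h.measurable n hn)).aestronglyMeasurable c
    (ae_of_all _ fun ω => hc _ (h.mem hn ω))

lemma IsPolicyGradient.integrable_continuous [IsFiniteMeasure P]
    (h : G.IsPolicyGradient P γ m p bb sd π V) {f : Profile I S A → ℝ} (hf : Continuous f)
    {n : ℕ} (hn : 1 ≤ n) : Integrable (fun ω => f (π n ω)) P :=
  h.integrable_comp hf.measurable hf.continuousOn hn

lemma IsPolicyGradient.integrable_signal [IsFiniteMeasure P]
    (h : G.IsPolicyGradient P γ m p bb sd π V) {n : ℕ} (hn : 1 ≤ n) : Integrable (V n) P :=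
  (h.signal_memLp n hn).integrable (by norm_num)

/-- The bias is bounded almost surely, being measurable with respect to the history. -/
lemma IsPolicyGradient.norm_bias_le [IsFiniteMeasure P]
    (h : G.IsPolicyGradient P γ m p bb sd π V) {n : ℕ} (hn : 1 ≤ n) :
    ∀ᵐ ω ∂P, ‖G.bias P π V n ω‖ ≤ |bb n| := by
  have hg : StronglyMeasurable[history π n] fun ω => G.gradField (π n ω) :=
    (G.measurable_gradField.comp (measurable_history π hn le_rfl)).stronglyMeasurable
  have hsm : StronglyMeasurable[history π n] fun ω => ‖G.bias P π V n ω‖ :=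
    (stronglyMeasurable_condExp.sub hg).norm
  have hint : Integrable (fun ω => ‖G.bias P π V n ω‖) P :=
    (integrable_condExp.sub
      (h.integrable_comp G.measurable_gradField G.continuousOn_gradField hn)).norm
  filter_upwards [h.bias_le n hn] with ω hω
  rw [condExp_of_stronglyMeasurable (h.history_le n) hsm hint] at hω
  exact hω.trans (le_abs_self _)

/-- The constant in front of the error term in the one-step inequality. -/
def stepConst (R Gb L₁ L₂ : ℝ) : ℝ :=
  2 * L₁ * R + (L₁ + 4 * R ^ 2 * L₂) * (4 + 4 * Gb ^ 2)

/-- The second moment of the gradient signal on an event of the past. -/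
lemma IsPolicyGradient.setIntegral_signal_sq_le [IsFiniteMeasure P]
    (h : G.IsPolicyGradient P γ m p bb sd π V) {Gb : ℝ}
    (hGb : ∀ x ∈ policies I S A, ‖G.gradField x‖ ≤ Gb) {n : ℕ} (hn : 1 ≤ n) {E : Set Ω}
    (hE : MeasurableSet[history π n] E) :
    ∫ ω in E, ‖V n ω‖ ^ 2 ∂P ≤
      (4 + 4 * Gb ^ 2) * (1 + bb n ^ 2 + sd n ^ 2) * P.real E := by
  have hle := h.history_le n
  set W := condExp (history π n) P (V n) with hW
  have hWb : ∀ᵐ ω ∂P, ‖W ω‖ ≤ Gb + |bb n| := by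
    filter_upwards [h.norm_bias_le hn] with ω hω
    have h1 : W ω = G.gradField (π n ω) + G.bias P π V n ω := by simp [bias, hW]
    rw [h1]
    exact (norm_add_le _ _).trans (add_le_add (hGb _ (h.mem hn ω)) hω)
  have hWm : MemLp W 2 P :=
    MemLp.of_bound integrable_condExp.aestronglyMeasurable _ hWb
  have hNm : MemLp (noise P π V n) 2 P := (h.signal_memLp n hn).sub hWm
  have hNi : Integrable (fun ω => ‖noise P π V n ω‖ ^ 2) P := hNm.integrable_norm_pow (by norm_num)
  have hN : ∫ ω in E, ‖noise P π V n ω‖ ^ 2 ∂P ≤ sd n ^ 2 * P.real E := by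
    rw [← setIntegral_condExp hle hNi hE]
    calc _ ≤ ∫ _ω in E, sd n ^ 2 ∂P :=
          setIntegral_mono_ae integrable_condExp.integrableOn (integrable_const _).integrableOn
            (h.noise_le n hn)
      _ = _ := by rw [setIntegral_const, smul_eq_mul, mul_comm]
  have hpt : ∀ᵐ ω ∂P, ‖V n ω‖ ^ 2 ≤ 2 * ‖noise P π V n ω‖ ^ 2 + 2 * (Gb + |bb n|) ^ 2 := by
    filter_upwards [hWb] with ω hω
    have h1 : V n ω = noise P π V n ω + W ω := by simp [noise, hW]
    have h2 : ‖V n ω‖ ≤ ‖noise P π V n ω‖ + (Gb + |bb n|) := by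
      rw [h1]
      exact (norm_add_le _ _).trans (add_le_add le_rfl hω)
    have h3 := pow_le_pow_left₀ (norm_nonneg _) h2 2
    nlinarith [sq_nonneg (‖noise P π V n ω‖ - (Gb + |bb n|))]
  calc ∫ ω in E, ‖V n ω‖ ^ 2 ∂P
      ≤ ∫ ω in E, (2 * ‖noise P π V n ω‖ ^ 2 + 2 * (Gb + |bb n|) ^ 2) ∂P :=
        setIntegral_mono_ae ((h.signal_memLp n hn).integrable_norm_pow (by norm_num)).integrableOn
          ((hNi.const_mul 2).add (integrable_const _)).integrableOn hpt
    _ = 2 * ∫ ω in E, ‖noise P π V n ω‖ ^ 2 ∂P + 2 * (Gb + |bb n|) ^ 2 * P.real E := by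
        rw [integral_add (hNi.const_mul 2).integrableOn (integrable_const _).integrableOn,
          integral_const_mul, setIntegral_const, smul_eq_mul]
        ring
    _ ≤ (2 * sd n ^ 2 + 2 * (Gb + |bb n|) ^ 2) * P.real E := by linarith
    _ ≤ _ := by
        refine mul_le_mul_of_nonneg_right ?_ measureReal_nonneg
        nlinarith [sq_abs (bb n), sq_nonneg (Gb - |bb n|), sq_nonneg (Gb * bb n),
          sq_nonneg (Gb * sd n), sq_nonneg (sd n), sq_nonneg (bb n)]

/-- The one-step inequality in expectation, on an event `E` of the past: the function `φ` of the
squared distance decreases by the drift, up to a summable error. -/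
lemma IsPolicyGradient.setIntegral_succ_le [IsFiniteMeasure P]
    (h : G.IsPolicyGradient P γ m p bb sd π V) (hγ : 0 < γ) (hm : 0 ≤ m) {π' : Profile I S A}
    (h' : π' ∈ policies I S A) {R Gb L₁ L₂ : ℝ} {φ φ' : ℝ → ℝ}
    (hR : ∀ x ∈ policies I S A, ‖x - π'‖ ≤ R)
    (hGb : ∀ x ∈ policies I S A, ‖G.gradField x‖ ≤ Gb)
    (hφc : Continuous φ) (hφc' : Continuous φ')
    (hφ : ∀ a ∈ Set.Icc 0 (R ^ 2), ∀ b ∈ Set.Icc 0 (R ^ 2),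
      φ b ≤ φ a + φ' a * (b - a) + L₂ * (b - a) ^ 2)
    (hφ' : ∀ a ∈ Set.Icc 0 (R ^ 2), 0 ≤ φ' a ∧ φ' a ≤ L₁) (hL₂ : 0 ≤ L₂)
    {n : ℕ} (hn : 1 ≤ n) {E : Set Ω} (hE : MeasurableSet[history π n] E) :
    ∫ ω in E, φ (‖π (n + 1) ω - π'‖ ^ 2) ∂P ≤
      ∫ ω in E, (φ (‖π n ω - π'‖ ^ 2) + 2 * stepSize γ m p n *
        (φ' (‖π n ω - π'‖ ^ 2) * inner ℝ (G.gradField (π n ω)) (π n ω - π'))) ∂P +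
      stepConst R Gb L₁ L₂ * errTerm γ m p bb sd n * P.real E := by
  have hle := h.history_le n
  have hs := stepSize_pos (p := p) hγ hm hn
  set s := stepSize γ m p n with hsdef
  set W := condExp (history π n) P (V n) with hW
  set F : Ω → Profile I S A := fun ω => φ' (‖π n ω - π'‖ ^ 2) • (π n ω - π') with hF
  have hR0 : 0 ≤ R := (norm_nonneg _).trans (hR π' h')
  have hmem : ∀ ω, ‖π n ω - π'‖ ^ 2 ∈ Set.Icc 0 (R ^ 2) := fun ω =>
    ⟨by positivity, pow_le_pow_left₀ (norm_nonneg _) (hR _ (h.mem hn ω)) 2⟩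
  have hL₁ : 0 ≤ L₁ := (hφ' 0 ⟨le_rfl, by positivity⟩).1.trans (hφ' 0 ⟨le_rfl, by positivity⟩).2
  have hFsm : StronglyMeasurable[history π n] F := by
    have : Continuous fun x : Profile I S A => φ' (‖x - π'‖ ^ 2) • (x - π') := by fun_prop
    exact (this.measurable.comp (measurable_history π hn le_rfl)).stronglyMeasurable
  have hFb : ∀ ω, ‖F ω‖ ≤ L₁ * R := fun ω => by
    obtain ⟨h1, h2⟩ := hφ' _ (hmem ω)
    rw [hF, norm_smul, Real.norm_of_nonneg h1]
    exact mul_le_mul h2 (hR _ (h.mem hn ω)) (norm_nonneg _) hL₁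
  have hVi := h.integrable_signal hn
  have hWi : Integrable W P := integrable_condExp
  have hFV : Integrable (fun ω => inner ℝ (F ω) (V n ω)) P := by
    refine (hVi.norm.const_mul (L₁ * R)).mono'
      ((hFsm.mono hle).aestronglyMeasurable.inner hVi.aestronglyMeasurable)
      (ae_of_all _ fun ω => ?_)
    exact (norm_inner_le_norm _ _).trans (mul_le_mul_of_nonneg_right (hFb ω) (norm_nonneg _))
  have hFW : Integrable (fun ω => inner ℝ (F ω) (W ω)) P := by
    refine (hWi.norm.const_mul (L₁ * R)).mono'
      ((hFsm.mono hle).aestronglyMeasurable.inner hWi.aestronglyMeasurable)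
      (ae_of_all _ fun ω => ?_)
    exact (norm_inner_le_norm _ _).trans (mul_le_mul_of_nonneg_right (hFb ω) (norm_nonneg _))
  have hpull : ∫ ω in E, inner ℝ (F ω) (V n ω) ∂P = ∫ ω in E, inner ℝ (F ω) (W ω) ∂P := by
    rw [← setIntegral_condExp hle hFV hE]
    refine integral_congr_ae (ae_restrict_of_ae ?_)
    exact condExp_bilin_of_stronglyMeasurable_left
      (innerSL ℝ : Profile I S A →L[ℝ] Profile I S A →L[ℝ] ℝ) hFsm hFV hVi
  have hgrad : Integrable (fun ω => φ' (‖π n ω - π'‖ ^ 2) *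
      inner ℝ (G.gradField (π n ω)) (π n ω - π')) P := by
    refine h.integrable_comp (f := fun x => φ' (‖x - π'‖ ^ 2) *
      inner ℝ (G.gradField x) (x - π')) ?_ ?_ hn
    · have h1 : Continuous fun x : Profile I S A => φ' (‖x - π'‖ ^ 2) := by fun_prop
      exact h1.measurable.mul (G.measurable_gradField.inner (measurable_id.sub_const π'))
    · have h1 := G.continuousOn_gradField
      fun_prop
  have hdrift : ∫ ω in E, inner ℝ (F ω) (W ω) ∂P ≤
      ∫ ω in E, φ' (‖π n ω - π'‖ ^ 2) * inner ℝ (G.gradField (π n ω)) (π n ω - π') ∂P +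
        L₁ * R * |bb n| * P.real E := by
    calc _ ≤ ∫ ω in E, (φ' (‖π n ω - π'‖ ^ 2) *
          inner ℝ (G.gradField (π n ω)) (π n ω - π') + L₁ * R * |bb n|) ∂P := by
          refine setIntegral_mono_ae hFW.integrableOn
            (hgrad.add (integrable_const _)).integrableOn ?_
          filter_upwards [h.norm_bias_le hn] with ω hω
          have h1 : W ω = G.gradField (π n ω) + G.bias P π V n ω := by simp [bias, hW]
          rw [h1, inner_add_right]
          refine add_le_add (le_of_eq ?_) ?_
          · rw [hF, inner_smul_left, conj_trivial, real_inner_comm]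
          · exact (real_inner_le_norm _ _).trans
              (mul_le_mul (hFb ω) hω (norm_nonneg _) (by positivity))
      _ = _ := by
          rw [integral_add hgrad.integrableOn (integrable_const _).integrableOn, setIntegral_const,
            smul_eq_mul]
          ring
  have hφi : ∀ k, 1 ≤ k → Integrable (fun ω => φ (‖π k ω - π'‖ ^ 2)) P := fun k hk =>
    h.integrable_continuous (f := fun x => φ (‖x - π'‖ ^ 2)) (by fun_prop) hk
  have hV2 : Integrable (fun ω => ‖V n ω‖ ^ 2) P :=
    (h.signal_memLp n hn).integrable_norm_pow (by norm_num)
  set c := L₁ + 4 * R ^ 2 * L₂ with hc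
  have hc0 : 0 ≤ c := by positivity
  have hsq := h.setIntegral_signal_sq_le hGb hn hE
  have hPE : 0 ≤ P.real E := measureReal_nonneg
  calc ∫ ω in E, φ (‖π (n + 1) ω - π'‖ ^ 2) ∂P
      ≤ ∫ ω in E, (φ (‖π n ω - π'‖ ^ 2) + 2 * s * inner ℝ (F ω) (V n ω) +
          s ^ 2 * c * ‖V n ω‖ ^ 2) ∂P :=
        setIntegral_mono (hφi _ (by omega)).integrableOn
          (((hφi n hn).add (hFV.const_mul _)).add (hV2.const_mul _)).integrableOn fun ω =>
          (h.update n hn ω).apply_sq_le hs.le h' hR hφ hφ' hL₂ (h.mem hn ω)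
    _ = ∫ ω in E, φ (‖π n ω - π'‖ ^ 2) ∂P + 2 * s * ∫ ω in E, inner ℝ (F ω) (W ω) ∂P +
          s ^ 2 * c * ∫ ω in E, ‖V n ω‖ ^ 2 ∂P := by
        have hadd : Integrable (fun ω => φ (‖π n ω - π'‖ ^ 2) + 2 * s * inner ℝ (F ω) (V n ω)) P :=
          (hφi n hn).add (hFV.const_mul _)
        rw [integral_add hadd.integrableOn (hV2.const_mul _).integrableOn,
          integral_add (hφi n hn).integrableOn
          (hFV.const_mul _).integrableOn, integral_const_mul, integral_const_mul, hpull]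
    _ ≤ ∫ ω in E, φ (‖π n ω - π'‖ ^ 2) ∂P + 2 * s * (∫ ω in E, φ' (‖π n ω - π'‖ ^ 2) *
          inner ℝ (G.gradField (π n ω)) (π n ω - π') ∂P + L₁ * R * |bb n| * P.real E) +
          s ^ 2 * c * ((4 + 4 * Gb ^ 2) * (1 + bb n ^ 2 + sd n ^ 2) * P.real E) := by
        gcongr
    _ ≤ _ := by
        rw [integral_add (hφi n hn).integrableOn (hgrad.const_mul _).integrableOn,
          integral_const_mul, stepConst, errTerm, ← hsdef, ← hc]
        have h1 : 0 ≤ 2 * L₁ * R * (s ^ 2 * (1 + bb n ^ 2 + sd n ^ 2)) * P.real E := by positivity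
        have h2 : 0 ≤ c * (4 + 4 * Gb ^ 2) * (s * |bb n|) * P.real E := by positivity
        linarith

end Dynamics

section Dynamics

variable {Ω : Type*} [MeasurableSpace Ω] {G : StochasticGame I S A} {P : Measure Ω}
  {γ m p : ℝ} {bb sd : ℕ → ℝ} {π V : ℕ → Ω → Profile I S A}

/-! ### Staying in the basin up to a given time -/

/-- The event that `π_1, …, π_n` all lie in `B`. -/
def stayUpTo (π : ℕ → Ω → Profile I S A) (B : Set (Profile I S A)) (n : ℕ) : Set Ω :=
  {ω | ∀ k, 1 ≤ k → k ≤ n → π k ω ∈ B}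

omit [Fintype I] [DecidableEq I] [Fintype S] [DecidableEq S] [∀ i, Fintype (A i)]
  [MeasurableSpace Ω] in
lemma measurableSet_stayUpTo (π : ℕ → Ω → Profile I S A) {B : Set (Profile I S A)}
    (hB : MeasurableSet B) (n : ℕ) : MeasurableSet[history π n] (stayUpTo π B n) := by
  have : stayUpTo π B n = ⋂ k ∈ Finset.Icc 1 n, π k ⁻¹' B := by
    ext
    simp [stayUpTo]
  rw [this]
  exact Finset.measurableSet_biInter _ fun k hk =>
    measurable_history π (Finset.mem_Icc.1 hk).1 (Finset.mem_Icc.1 hk).2 hB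

omit [Fintype I] [DecidableEq I] [Fintype S] [DecidableEq S] [∀ i, Fintype (A i)]
  [MeasurableSpace Ω] in
lemma stayUpTo_antitone (π : ℕ → Ω → Profile I S A) (B : Set (Profile I S A)) :
    Antitone (stayUpTo π B) := fun _ _ hij _ hω k hk hki => hω k hk (hki.trans hij)

omit [Fintype I] [DecidableEq I] [Fintype S] [DecidableEq S] [∀ i, Fintype (A i)]
  [MeasurableSpace Ω] in
lemma stayEvent_subset_stayUpTo (π : ℕ → Ω → Profile I S A) (B : Set (Profile I S A)) (n : ℕ) :
    stayEvent π B ⊆ stayUpTo π B n := fun _ hω k hk _ => hω k hk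

omit [Fintype I] [DecidableEq I] [Fintype S] [DecidableEq S] [∀ i, Fintype (A i)]
  [MeasurableSpace Ω] in
lemma stayEvent_eq_iInter (π : ℕ → Ω → Profile I S A) (B : Set (Profile I S A)) :
    stayEvent π B = ⋂ N, stayUpTo π B (N + 1) := by
  refine Set.Subset.antisymm (Set.subset_iInter fun N => stayEvent_subset_stayUpTo π B _) ?_
  intro ω hω k hk
  exact Set.mem_iInter.1 hω k k hk (Nat.le_succ k)

omit [DecidableEq I] [DecidableEq S] in
lemma exists_dist_bound (π' : Profile I S A) :
    ∃ R : ℝ, ∀ x ∈ policies I S A, ‖x - π'‖ ≤ R := by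
  obtain ⟨R, hR⟩ := (isCompact_policies (I := I) (S := S) (A := A)).exists_bound_of_continuousOn
    (f := fun x => x - π') (by fun_prop)
  exact ⟨R, hR⟩

lemma exists_gradField_bound (G : StochasticGame I S A) :
    ∃ Gb : ℝ, ∀ x ∈ policies I S A, ‖G.gradField x‖ ≤ Gb :=
  isCompact_policies.exists_bound_of_continuousOn G.continuousOn_gradField

/-! ### Containment with high probability -/

/-- The probability of ever leaving `B` after a start in `π_1 ∈ U` is controlled by the total error.
The Lyapunov function `((D - r²)⁺)²` of the squared distance `D` vanishes on `U` and is at least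
`9 r⁴` outside `B`, so that every exit from `B` consumes that amount of the total error. -/
lemma IsPolicyGradient.measure_diff_stayEvent_le [IsProbabilityMeasure P]
    (h : G.IsPolicyGradient P γ m p bb sd π V) (hγ : 0 < γ) (hm : 0 ≤ m) {π' : Profile I S A}
    (h' : π' ∈ policies I S A) {R Gb : ℝ} (hR : ∀ x ∈ policies I S A, ‖x - π'‖ ≤ R)
    (hGb : ∀ x ∈ policies I S A, ‖G.gradField x‖ ≤ Gb)
    (hsum : Summable fun n => errTerm γ m p bb sd (n + 1))
    {μ : ℝ} (hμ : 0 < μ) {B U : Set (Profile I S A)} (hBm : MeasurableSet B) (hUm : MeasurableSet U)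
    (hQ : G.QuadraticBoundOn π' μ B) {r : ℝ} (hr : 0 < r)
    (hrB : ∀ x ∈ policies I S A, x ∉ B → 2 * r ≤ ‖x - π'‖)
    (hUr : ∀ x ∈ U, ‖x - π'‖ ≤ r) (hUB : U ⊆ B) :
    9 * r ^ 4 * P.real ({ω | π 1 ω ∈ U} \ stayEvent π B) ≤
      stepConst R Gb (2 * R ^ 2) 1 * (∑' n, errTerm γ m p bb sd (n + 1)) *
        P.real {ω | π 1 ω ∈ U} := by
  set C := stepConst R Gb (2 * R ^ 2) 1 with hC
  set U₁ : Set Ω := {ω | π 1 ω ∈ U} with hU₁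
  set φ : ℝ → ℝ := fun x => max (x - r ^ 2) 0 ^ 2 with hφ
  have hR0 : 0 ≤ R := (norm_nonneg _).trans (hR π' h')
  have hC0 : 0 ≤ C := by
    rw [hC, stepConst]
    positivity
  have herr0 : ∀ n, 0 ≤ errTerm γ m p bb sd (n + 1) := fun n =>
    errTerm_nonneg hγ hm _ _ (by omega)
  have hφi : ∀ n, 1 ≤ n → Integrable (fun ω => φ (‖π n ω - π'‖ ^ 2)) P := fun n hn =>
    h.integrable_continuous (f := fun x => φ (‖x - π'‖ ^ 2)) (by fun_prop) hn
  have hUn : ∀ n, 1 ≤ n → MeasurableSet[history π n] U₁ := fun n hn =>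
    measurable_history π le_rfl hn hUm
  have hquad : ∀ a b : ℝ, φ b ≤ φ a + 2 * max (a - r ^ 2) 0 * (b - a) + 1 * (b - a) ^ 2 := by
    intro a b
    simp only [hφ]
    have h1 : 0 ≤ max (b - r ^ 2) 0 := le_max_right _ _
    rcases le_total (a - r ^ 2) 0 with ha | ha
    · rw [max_eq_right ha]
      rcases le_total (b - r ^ 2) 0 with hb | hb
      · rw [max_eq_right hb]
        nlinarith [sq_nonneg (b - a)]
      · rw [max_eq_left hb]
        nlinarith
    · rw [max_eq_left ha]
      rcases le_total (b - r ^ 2) 0 with hb | hb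
      · rw [max_eq_right hb]
        nlinarith [sq_nonneg (b - r ^ 2)]
      · rw [max_eq_left hb]
        nlinarith
  have hmain : ∀ N : ℕ, ∫ ω in U₁ ∩ stayUpTo π B (N + 1), φ (‖π (N + 1) ω - π'‖ ^ 2) ∂P +
      9 * r ^ 4 * P.real (U₁ \ stayUpTo π B (N + 1)) ≤
      C * (∑ n ∈ Finset.range N, errTerm γ m p bb sd (n + 1)) * P.real U₁ := by
    intro N
    induction N with
    | zero =>
      have h1 : U₁ \ stayUpTo π B (0 + 1) = ∅ := by
        refine Set.sdiff_eq_empty.2 fun ω hω k hk hk1 => ?_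
        obtain rfl : k = 1 := by omega
        exact hUB hω
      have h2 : ∫ ω in U₁ ∩ stayUpTo π B (0 + 1), φ (‖π (0 + 1) ω - π'‖ ^ 2) ∂P = 0 := by
        refine setIntegral_eq_zero_of_forall_eq_zero fun ω hω => ?_
        have h3 : ‖π 1 ω - π'‖ ^ 2 ≤ r ^ 2 := pow_le_pow_left₀ (norm_nonneg _) (hUr _ hω.1) 2
        simp only [hφ, zero_add]
        rw [max_eq_right (by linarith)]
        norm_num
      rw [h1, h2]
      simp
    | succ N ih =>
      set E := U₁ ∩ stayUpTo π B (N + 1) with hE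
      set E' := U₁ ∩ stayUpTo π B (N + 1 + 1) with hE'
      have hEm : MeasurableSet[history π (N + 1)] E :=
        (hUn _ (by omega)).inter (measurableSet_stayUpTo π hBm _)
      have hEm' : MeasurableSet E' :=
        h.history_le _ _ ((hUn (N + 1 + 1) (by omega)).inter (measurableSet_stayUpTo π hBm _))
      have hEE : E' ⊆ E := Set.inter_subset_inter_right _ (stayUpTo_antitone π B (Nat.le_succ _))
      have hstep := h.setIntegral_succ_le hγ hm h' (φ := φ)
        (φ' := fun x => 2 * max (x - r ^ 2) 0) (L₁ := 2 * R ^ 2) (L₂ := 1) hR hGb (by fun_prop)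
        (by fun_prop) (fun a _ b _ => hquad a b) (fun a ha => ⟨by positivity, by
          have : max (a - r ^ 2) 0 ≤ R ^ 2 :=
            max_le (by nlinarith [ha.2, sq_nonneg r]) (by positivity)
          linarith⟩) zero_le_one (by omega : 1 ≤ N + 1) hEm
      rw [← hC] at hstep
      have hEle : P.real E ≤ P.real U₁ := measureReal_mono Set.inter_subset_left
      -- the drift points towards `π'` as long as the process is in the basin
      have hdrift : ∫ ω in E, (φ (‖π (N + 1) ω - π'‖ ^ 2) + 2 * stepSize γ m p (N + 1) *
          (2 * max (‖π (N + 1) ω - π'‖ ^ 2 - r ^ 2) 0 *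
            inner ℝ (G.gradField (π (N + 1) ω)) (π (N + 1) ω - π'))) ∂P ≤
          ∫ ω in E, φ (‖π (N + 1) ω - π'‖ ^ 2) ∂P := by
        refine setIntegral_mono_on ?_ (hφi _ (by omega)).integrableOn (h.history_le _ _ hEm)
          fun ω hω => ?_
        · refine (h.integrable_comp (f := fun x => φ (‖x - π'‖ ^ 2) + 2 * stepSize γ m p (N + 1) *
            (2 * max (‖x - π'‖ ^ 2 - r ^ 2) 0 * inner ℝ (G.gradField x) (x - π')))
            ?_ ?_ (by omega)).integrableOn
          · have h1 := G.measurable_gradField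
            have h2 : Measurable fun x => inner ℝ (G.gradField x) (x - π') :=
              h1.inner (measurable_id.sub_const π')
            have h3 : Measurable fun x : Profile I S A => φ (‖x - π'‖ ^ 2) :=
              Continuous.measurable (by fun_prop)
            have h4 : Measurable fun x : Profile I S A => 2 * max (‖x - π'‖ ^ 2 - r ^ 2) 0 :=
              Continuous.measurable (by fun_prop)
            exact h3.add ((h4.mul h2).const_mul _)
          · have h1 := G.continuousOn_gradField
            fun_prop
        · have h1 := hQ _ (hω.2 (N + 1) (by omega) le_rfl)
          have h2 : inner ℝ (G.gradField (π (N + 1) ω)) (π (N + 1) ω - π') ≤ 0 :=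
            h1.trans (by nlinarith [sq_nonneg ‖π (N + 1) ω - π'‖])
          have h3 := stepSize_pos (p := p) hγ hm (by omega : 1 ≤ N + 1)
          have h4 : 2 * max (‖π (N + 1) ω - π'‖ ^ 2 - r ^ 2) 0 *
              inner ℝ (G.gradField (π (N + 1) ω)) (π (N + 1) ω - π') ≤ 0 :=
            mul_nonpos_of_nonneg_of_nonpos (by positivity) h2
          nlinarith
      -- the cost of leaving the basin at time `N + 2`
      have hexit : ∫ ω in E', φ (‖π (N + 1 + 1) ω - π'‖ ^ 2) ∂P + 9 * r ^ 4 * P.real (E \ E') ≤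
          ∫ ω in E, φ (‖π (N + 1 + 1) ω - π'‖ ^ 2) ∂P := by
        have h1 : ∫ _ω in E \ E', 9 * r ^ 4 ∂P ≤
            ∫ ω in E \ E', φ (‖π (N + 1 + 1) ω - π'‖ ^ 2) ∂P := by
          refine setIntegral_mono_on (integrable_const _).integrableOn
            (hφi _ (by omega)).integrableOn ((h.history_le _ _ hEm).diff hEm') fun ω hω => ?_
          have h2 : π (N + 1 + 1) ω ∉ B := fun hB => hω.2 ⟨hω.1.1, fun k hk hkN => by
            rcases Nat.le_succ_iff.1 hkN with hk' | rfl
            · exact hω.1.2 k hk hk'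
            · exact hB⟩
          have h3 := hrB _ (h.mem (by omega) ω) h2
          have h4 : 3 * r ^ 2 ≤ ‖π (N + 1 + 1) ω - π'‖ ^ 2 - r ^ 2 := by nlinarith
          calc 9 * r ^ 4 = (3 * r ^ 2) ^ 2 := by ring
            _ ≤ φ (‖π (N + 1 + 1) ω - π'‖ ^ 2) :=
              pow_le_pow_left₀ (by positivity) (h4.trans (le_max_left _ _)) 2
        rw [setIntegral_const, smul_eq_mul] at h1
        have h5 := integral_inter_add_sdiff (s := E) hEm' (hφi (N + 1 + 1) (by omega)).integrableOn
        rw [Set.inter_eq_self_of_subset_right hEE] at h5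
        linarith
      have hsplit : P.real (U₁ \ stayUpTo π B (N + 1 + 1)) =
          P.real (U₁ \ stayUpTo π B (N + 1)) + P.real (E \ E') := by
        rw [← measureReal_union _ ((h.history_le _ _ hEm).diff hEm')]
        · congr 1
          ext ω
          have := @stayUpTo_antitone _ _ _ _ π B _ _ (Nat.le_succ (N + 1)) ω
          simp only [hE, hE', Set.mem_sdiff, Set.mem_inter_iff, Set.mem_union]
          tauto
        · refine Set.disjoint_left.2 fun ω h1 h2 => h1.2 h2.1.2
      rw [hsplit, Finset.sum_range_succ]
      have h6 : C * errTerm γ m p bb sd (N + 1) * P.real E ≤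
          C * errTerm γ m p bb sd (N + 1) * P.real U₁ :=
        mul_le_mul_of_nonneg_left hEle (mul_nonneg hC0 (herr0 N))
      linarith
  have hbound : ∀ N : ℕ, 9 * r ^ 4 * P.real (U₁ \ stayUpTo π B (N + 1)) ≤
      C * (∑' n, errTerm γ m p bb sd (n + 1)) * P.real U₁ := by
    intro N
    have h1 : 0 ≤ ∫ ω in U₁ ∩ stayUpTo π B (N + 1), φ (‖π (N + 1) ω - π'‖ ^ 2) ∂P :=
      integral_nonneg fun ω => by positivity
    have h2 : C * (∑ n ∈ Finset.range N, errTerm γ m p bb sd (n + 1)) * P.real U₁ ≤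
        C * (∑' n, errTerm γ m p bb sd (n + 1)) * P.real U₁ := by
      refine mul_le_mul_of_nonneg_right (mul_le_mul_of_nonneg_left ?_ hC0) measureReal_nonneg
      exact hsum.sum_le_tsum _ fun n _ => herr0 n
    linarith [hmain N]
  have hlim : Tendsto (fun N => P.real (U₁ \ stayUpTo π B (N + 1))) atTop
      (𝓝 (P.real (U₁ \ stayEvent π B))) := by
    rw [stayEvent_eq_iInter, Set.sdiff_iInter]
    refine (ENNReal.tendsto_toReal (measure_ne_top P _)).comp (tendsto_measure_iUnion_atTop ?_)
    exact fun i j hij => Set.sdiff_subset_sdiff_right (stayUpTo_antitone π B (by omega))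
  exact le_of_tendsto' (hlim.const_mul _) hbound

/-! ### Decay of the mean squared distance -/

/-- The mean of a Lyapunov function `φ` of the squared distance, on the event of having stayed in
the basin, obeys a contractive recursion. -/
lemma IsPolicyGradient.recursion_stayUpTo [IsProbabilityMeasure P]
    (h : G.IsPolicyGradient P γ m p bb sd π V) (hγ : 0 < γ) (hm : 0 ≤ m) {π' : Profile I S A}
    (h' : π' ∈ policies I S A) {R Gb L₁ L₂ κ : ℝ} {φ φ' : ℝ → ℝ}
    (hR : ∀ x ∈ policies I S A, ‖x - π'‖ ≤ R)
    (hGb : ∀ x ∈ policies I S A, ‖G.gradField x‖ ≤ Gb)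
    (hφc : Continuous φ) (hφc' : Continuous φ')
    (hφ : ∀ a ∈ Set.Icc 0 (R ^ 2), ∀ b ∈ Set.Icc 0 (R ^ 2),
      φ b ≤ φ a + φ' a * (b - a) + L₂ * (b - a) ^ 2)
    (hφ' : ∀ a ∈ Set.Icc 0 (R ^ 2), 0 ≤ φ' a ∧ φ' a ≤ L₁) (hL₂ : 0 ≤ L₂)
    (hφ0 : ∀ a, 0 ≤ a → 0 ≤ φ a) {B : Set (Profile I S A)} (hBm : MeasurableSet B)
    (hdrift : ∀ x ∈ policies I S A, x ∈ B → φ' (‖x - π'‖ ^ 2) *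
      inner ℝ (G.gradField x) (x - π') ≤ -κ * φ (‖x - π'‖ ^ 2))
    {n : ℕ} (hn : 1 ≤ n) {E : Set Ω} (hE : MeasurableSet[history π n] E) :
    ∫ ω in E ∩ stayUpTo π B (n + 1), φ (‖π (n + 1) ω - π'‖ ^ 2) ∂P ≤
      (1 - 2 * κ * stepSize γ m p n) *
        ∫ ω in E ∩ stayUpTo π B n, φ (‖π n ω - π'‖ ^ 2) ∂P +
      stepConst R Gb L₁ L₂ * errTerm γ m p bb sd n * P.real E := by
  have hEm : MeasurableSet[history π n] (E ∩ stayUpTo π B n) :=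
    hE.inter (measurableSet_stayUpTo π hBm n)
  have hφi : ∀ k, 1 ≤ k → Integrable (fun ω => φ (‖π k ω - π'‖ ^ 2)) P := fun k hk =>
    h.integrable_continuous (f := fun x => φ (‖x - π'‖ ^ 2)) (by fun_prop) hk
  have hR0 : 0 ≤ R := (norm_nonneg _).trans (hR π' h')
  have hL₁ : 0 ≤ L₁ := (hφ' 0 ⟨le_rfl, by positivity⟩).1.trans (hφ' 0 ⟨le_rfl, by positivity⟩).2
  have hC0 : 0 ≤ stepConst R Gb L₁ L₂ := by
    unfold stepConst
    positivity
  have herr := errTerm_nonneg (p := p) hγ hm bb sd hn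
  have hs := stepSize_pos (p := p) hγ hm hn
  calc ∫ ω in E ∩ stayUpTo π B (n + 1), φ (‖π (n + 1) ω - π'‖ ^ 2) ∂P
      ≤ ∫ ω in E ∩ stayUpTo π B n, φ (‖π (n + 1) ω - π'‖ ^ 2) ∂P :=
        setIntegral_mono_set (hφi _ (by omega)).integrableOn
          (ae_of_all _ fun ω => hφ0 _ (by positivity))
          (Set.inter_subset_inter_right _ (stayUpTo_antitone π B (Nat.le_succ n))).eventuallyLE
    _ ≤ ∫ ω in E ∩ stayUpTo π B n, (φ (‖π n ω - π'‖ ^ 2) + 2 * stepSize γ m p n *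
          (φ' (‖π n ω - π'‖ ^ 2) * inner ℝ (G.gradField (π n ω)) (π n ω - π'))) ∂P +
          stepConst R Gb L₁ L₂ * errTerm γ m p bb sd n * P.real (E ∩ stayUpTo π B n) :=
        h.setIntegral_succ_le hγ hm h' hR hGb hφc hφc' hφ hφ' hL₂ hn hEm
    _ ≤ ∫ ω in E ∩ stayUpTo π B n, (1 - 2 * κ * stepSize γ m p n) * φ (‖π n ω - π'‖ ^ 2) ∂P +
          stepConst R Gb L₁ L₂ * errTerm γ m p bb sd n * P.real E := by
        refine add_le_add (setIntegral_mono_on ?_ ((hφi n hn).const_mul _).integrableOn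
          (h.history_le _ _ hEm) fun ω hω => ?_) (mul_le_mul_of_nonneg_left
            (measureReal_mono Set.inter_subset_left) (by positivity))
        · refine (h.integrable_comp (f := fun x => φ (‖x - π'‖ ^ 2) + 2 * stepSize γ m p n *
            (φ' (‖x - π'‖ ^ 2) * inner ℝ (G.gradField x) (x - π'))) ?_ ?_ hn).integrableOn
          · have h2 : Measurable fun x => inner ℝ (G.gradField x) (x - π') :=
              G.measurable_gradField.inner (measurable_id.sub_const π')
            have h3 : Measurable fun x : Profile I S A => φ (‖x - π'‖ ^ 2) :=
              Continuous.measurable (by fun_prop)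
            have h4 : Measurable fun x : Profile I S A => φ' (‖x - π'‖ ^ 2) :=
              Continuous.measurable (by fun_prop)
            exact h3.add ((h4.mul h2).const_mul _)
          · have h1 := G.continuousOn_gradField
            fun_prop
        · have h1 := mul_le_mul_of_nonneg_left
            (hdrift _ (h.mem hn ω) (hω.2 n hn le_rfl)) (by positivity : 0 ≤ 2 * stepSize γ m p n)
          linarith
    _ = _ := by rw [integral_const_mul]

/-- The decay rates of the mean squared distance on the event of having stayed in the basin. In the
fast regime the Lyapunov function `D + D² / r` replaces the squared distance `D`: where `D ≤ r` it
profits from the improved drift, where `D ≥ r` from its convexity, and the resulting contraction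
constant `3 μ / 2` exceeds `μ`, which takes care of the boundary case `2 μ γ = q`. -/
lemma IsPolicyGradient.isBigO_stayUpTo [IsProbabilityMeasure P]
    (h : G.IsPolicyGradient P γ m p bb sd π V) (hγ : 0 < γ) (hm : 0 ≤ m) {π' : Profile I S A}
    (h' : π' ∈ policies I S A) {lb ls : ℝ} (hp : 1 / 2 < p) (hp1 : p ≤ 1) (hls : 0 ≤ ls)
    (hlb : 1 < p + lb) (hpls : 1 / 2 < p - ls)
    (hbb : bb =O[atTop] (fun n : ℕ => (n : ℝ) ^ (-lb)))
    (hsd : sd =O[atTop] (fun n : ℕ => (n : ℝ) ^ ls))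
    {μ : ℝ} (hμ : 0 < μ) {B : Set (Profile I S A)} (hBm : MeasurableSet B)
    (hQ : G.QuadraticBoundOn π' μ B) {r : ℝ} (hr : 0 < r)
    (himp : ∀ x ∈ policies I S A, ‖x - π'‖ ^ 2 ≤ r →
      inner ℝ (G.gradField x) (x - π') ≤ -(2 * μ) * ‖x - π'‖ ^ 2) :
    ((p = 1 ∧ 2 * μ * γ < min lb (p - 2 * ls)) →
      (fun n : ℕ => ∫ ω in stayUpTo π B n, ‖π n ω - π'‖ ^ 2 ∂P)
        =O[atTop] (fun n : ℕ => (n : ℝ) ^ (-(2 * μ * γ)))) ∧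
    (¬ (p = 1 ∧ 2 * μ * γ < min lb (p - 2 * ls)) →
      (fun n : ℕ => ∫ ω in stayUpTo π B n, ‖π n ω - π'‖ ^ 2 ∂P)
        =O[atTop] (fun n : ℕ => (n : ℝ) ^ (-(min lb (p - 2 * ls))))) := by
  obtain ⟨R, hR⟩ := exists_dist_bound π'
  obtain ⟨Gb, hGb⟩ := G.exists_gradField_bound
  have hR0 : 0 ≤ R := (norm_nonneg _).trans (hR π' h')
  have herr := isBigO_errTerm (m := m) hγ hm hp hls (by linarith : 0 ≤ lb) hbb hsd
  have hq : 0 < min lb (p - 2 * ls) := lt_min (by linarith) (by linarith)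
  constructor
  · rintro ⟨rfl, hlt⟩
    refine isBigO_of_recursion_slow (κ := 2 * μ) hγ hm (by positivity) hlt
      (fun n => integral_nonneg fun ω => by positivity) (fun n hn => ?_)
      (herr.const_mul_left (stepConst R Gb 1 0))
    simpa using h.recursion_stayUpTo hγ hm h' (φ := fun x => x) (φ' := fun _ => 1) (L₁ := 1)
      (L₂ := 0) (κ := μ) hR hGb continuous_id continuous_const
      (fun a _ b _ => by linarith) (fun a _ => ⟨zero_le_one, le_rfl⟩) le_rfl (fun a ha => ha) hBm
      (fun x _ hx => by
        rw [one_mul]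
        exact hQ x hx) hn MeasurableSet.univ
  · intro hcase
    have hD : (fun n : ℕ => ∫ ω in stayUpTo π B n, ‖π n ω - π'‖ ^ 2 ∂P) =O[atTop]
        fun n : ℕ => ∫ ω in stayUpTo π B n,
          (‖π n ω - π'‖ ^ 2 + r⁻¹ * (‖π n ω - π'‖ ^ 2) ^ 2) ∂P := by
      refine IsBigO.of_bound 1 ?_
      filter_upwards [eventually_ge_atTop 1] with n hn
      rw [one_mul, Real.norm_of_nonneg (integral_nonneg fun ω => by positivity),
        Real.norm_of_nonneg (integral_nonneg fun ω => by positivity)]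
      refine setIntegral_mono
        (h.integrable_continuous (f := fun x => ‖x - π'‖ ^ 2) (by fun_prop) hn).integrableOn
        (h.integrable_continuous (f := fun x => ‖x - π'‖ ^ 2 + r⁻¹ * (‖x - π'‖ ^ 2) ^ 2)
          (by fun_prop) hn).integrableOn fun ω => ?_
      have : 0 ≤ r⁻¹ * (‖π n ω - π'‖ ^ 2) ^ 2 := by positivity
      exact le_add_of_nonneg_right this
    refine hD.trans ?_
    refine isBigO_of_recursion (p := p) (κ := 3 * μ) hγ hm (by linarith) (by positivity) hq ?_
      (fun n => integral_nonneg fun ω => by positivity) (fun n hn => ?_)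
      (herr.const_mul_left (stepConst R Gb (1 + 2 * r⁻¹ * R ^ 2) r⁻¹))
    · rcases hp1.lt_or_eq with hlt | rfl
      · exact Or.inl hlt
      · refine Or.inr ⟨rfl, ?_⟩
        have : min lb (1 - 2 * ls) ≤ 2 * μ * γ := by
          by_contra hcon
          exact hcase ⟨rfl, not_le.1 hcon⟩
        nlinarith [mul_pos hμ hγ]
    · have hrec := h.recursion_stayUpTo hγ hm h' (φ := fun x => x + r⁻¹ * x ^ 2)
        (φ' := fun x => 1 + 2 * r⁻¹ * x) (L₁ := 1 + 2 * r⁻¹ * R ^ 2)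
        (L₂ := r⁻¹) (κ := 3 * μ / 2) hR hGb (by fun_prop) (by fun_prop)
        (fun a _ b _ => by
          have : b + r⁻¹ * b ^ 2 = a + r⁻¹ * a ^ 2 + (1 + 2 * r⁻¹ * a) * (b - a) +
            r⁻¹ * (b - a) ^ 2 := by ring
          exact this.le)
        (fun a ha => ⟨by have := ha.1; positivity, by have := ha.2; gcongr⟩) (by positivity)
        (fun a ha => by positivity) hBm
        (fun x hx hxB => by
          set D := ‖x - π'‖ ^ 2 with hDdef
          have hD0 : 0 ≤ D := by positivity
          have hy : 0 ≤ r⁻¹ * D := by positivity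
          have hf : -(3 * μ / 2) * (D + r⁻¹ * D ^ 2) =
            -(3 / 2) * (1 + r⁻¹ * D) * (μ * D) := by ring
          rw [hf]
          have hμD : 0 ≤ μ * D := by positivity
          have hc : 0 ≤ 1 + 2 * r⁻¹ * D := by positivity
          rcases le_total D r with hle | hge
          · have h1 := mul_le_mul_of_nonneg_left (himp x hx hle) hc
            nlinarith [mul_nonneg hy hμD]
          · have h1 := mul_le_mul_of_nonneg_left (hQ x hxB) hc
            have h2 : 1 ≤ r⁻¹ * D := by
              rw [inv_mul_eq_div, one_le_div hr]
              exact hge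
            nlinarith [mul_nonneg (sub_nonneg.2 h2) hμD]) hn MeasurableSet.univ
      simp only [Set.univ_inter, probReal_univ, mul_one] at hrec
      have h2 : 2 * (3 * μ / 2) = 3 * μ := by ring
      rw [h2] at hrec
      exact hrec

lemma IsPolicyGradient.integral_cond_isBigO [IsProbabilityMeasure P]
    (h : G.IsPolicyGradient P γ m p bb sd π V) (π' : Profile I S A) (B : Set (Profile I S A)) :
    (fun n : ℕ => ∫ ω, ‖π n ω - π'‖ ^ 2 ∂(ProbabilityTheory.cond P (stayEvent π B))) =O[atTop]
      fun n : ℕ => ∫ ω in stayUpTo π B n, ‖π n ω - π'‖ ^ 2 ∂P := by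
  -- when `P (stayEvent π B) = 0` the constant is `∞.toReal = 0`, and the
  -- conditional measure is zero
  refine IsBigO.of_bound ((P (stayEvent π B))⁻¹).toReal ?_
  filter_upwards [eventually_ge_atTop 1] with n hn
  rw [Real.norm_of_nonneg (integral_nonneg fun ω => by positivity),
    Real.norm_of_nonneg (integral_nonneg fun ω => by positivity), ProbabilityTheory.cond,
    integral_smul_measure, smul_eq_mul]
  refine mul_le_mul_of_nonneg_left ?_ ENNReal.toReal_nonneg
  exact setIntegral_mono_set
    (h.integrable_continuous (f := fun x => ‖x - π'‖ ^ 2) (by fun_prop) hn).integrableOn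
    (ae_of_all _ fun ω => by positivity) (stayEvent_subset_stayUpTo π B n).eventuallyLE

/-! ### Almost sure convergence -/

/-- On the event of staying in the basin, the squared distance converges almost surely, being a
supermartingale up to summable errors; its limit is zero because its mean tends to zero. -/
lemma IsPolicyGradient.ae_tendsto [IsProbabilityMeasure P]
    (h : G.IsPolicyGradient P γ m p bb sd π V) (hγ : 0 < γ) (hm : 0 ≤ m) {π' : Profile I S A}
    (h' : π' ∈ policies I S A) (hsum : Summable fun n => errTerm γ m p bb sd (n + 1))
    {μ : ℝ} (hμ : 0 < μ) {B : Set (Profile I S A)} (hBm : MeasurableSet B)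
    (hQ : G.QuadraticBoundOn π' μ B)
    (hmean : Tendsto (fun n : ℕ => ∫ ω in stayUpTo π B n, ‖π n ω - π'‖ ^ 2 ∂P) atTop (𝓝 0)) :
    ∀ᵐ ω ∂P, ω ∈ stayEvent π B → ω ∈ convergeEvent π π' := by
  obtain ⟨R, hR⟩ := exists_dist_bound π'
  obtain ⟨Gb, hGb⟩ := G.exists_gradField_bound
  have hR0 : 0 ≤ R := (norm_nonneg _).trans (hR π' h')
  set C := stepConst R Gb 1 0 with hC
  have hC0 : 0 ≤ C := by
    rw [hC, stepConst]
    positivity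
  set err : ℕ → ℝ := fun n => C * errTerm γ m p bb sd (n + 1) with herr
  have herr0 : ∀ n, 0 ≤ err n := fun n =>
    mul_nonneg hC0 (errTerm_nonneg hγ hm _ _ (by omega))
  have herrs : Summable err := hsum.mul_left C
  -- time is shifted by one, as the process starts at index `1`
  let ℱ : Filtration ℕ ‹MeasurableSpace Ω› :=
    ⟨fun n => history π (n + 1), fun i j hij => history_mono π (by omega), fun n => h.history_le _⟩
  set Y : ℕ → Ω → ℝ := fun n =>
    (stayUpTo π B (n + 1)).indicator fun ω => ‖π (n + 1) ω - π'‖ ^ 2 with hY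
  have hYm : ∀ n, StronglyMeasurable[history π (n + 1)] (Y n) := by
    intro n
    have h1 : Continuous fun x : Profile I S A => ‖x - π'‖ ^ 2 := by fun_prop
    exact ((h1.measurable.comp (measurable_history π (by omega) le_rfl)).stronglyMeasurable)
      |>.indicator (measurableSet_stayUpTo π hBm _)
  have hY0 : ∀ n ω, 0 ≤ Y n ω := fun n ω => Set.indicator_nonneg (fun ω _ => by positivity) ω
  have hYR : ∀ n ω, Y n ω ≤ R ^ 2 := fun n ω => by
    refine Set.indicator_apply_le' (fun _ => ?_) fun _ => by positivity
    exact pow_le_pow_left₀ (norm_nonneg _) (hR _ (h.mem (by omega) ω)) 2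
  have hYi : ∀ n, Integrable (Y n) P := fun n =>
    Integrable.of_bound ((hYm n).mono (h.history_le _)).aestronglyMeasurable (R ^ 2)
      (ae_of_all _ fun ω => by
        rw [Real.norm_of_nonneg (hY0 n ω)]
        exact hYR n ω)
  set Z : ℕ → Ω → ℝ := fun n ω => ∑ k ∈ Finset.range n, err k - Y n ω with hZ
  -- the accumulated errors compensate the possible mean increase of `Y`
  have hsub : Submartingale Z ℱ P := by
    refine submartingale_of_setIntegral_le_succ
      (fun n => stronglyMeasurable_const.sub (hYm n))
      (fun n => (integrable_const _).sub (hYi n)) fun n s hs => ?_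
    have hsm : MeasurableSet s := h.history_le _ _ hs
    have hint : ∀ k, ∫ ω in s, Z k ω ∂P = (∑ j ∈ Finset.range k, err j) * P.real s -
        ∫ ω in s ∩ stayUpTo π B (k + 1), ‖π (k + 1) ω - π'‖ ^ 2 ∂P := by
      intro k
      simp only [hZ]
      rw [integral_sub (integrable_const _).integrableOn (hYi k).integrableOn, setIntegral_const,
        smul_eq_mul, mul_comm, hY,
        setIntegral_indicator (h.history_le _ _ (measurableSet_stayUpTo π hBm _))]
    rw [hint, hint, Finset.sum_range_succ]
    have hrec := h.recursion_stayUpTo hγ hm h' (φ := fun x => x) (φ' := fun _ => 1) (L₁ := 1)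
      (L₂ := 0) (κ := 0) hR hGb continuous_id continuous_const
      (fun a _ b _ => by linarith) (fun a _ => ⟨zero_le_one, le_rfl⟩) le_rfl (fun a ha => ha) hBm
      (fun x _ hx => by
        have := hQ x hx
        nlinarith [sq_nonneg ‖x - π'‖]) (by omega : 1 ≤ n + 1) hs
    simp only [mul_zero, zero_mul, sub_zero, one_mul] at hrec
    simp only [herr]
    linarith
  have hbdd : ∀ n, eLpNorm (Z n) 1 P ≤ ((∑' k, err k + R ^ 2).toNNReal : ENNReal) := by
    intro n
    refine (eLpNorm_le_of_ae_bound (C := ∑' k, err k + R ^ 2) (ae_of_all _ fun ω => ?_)).trans ?_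
    · have h1 : ∑ k ∈ Finset.range n, err k ≤ ∑' k, err k :=
        herrs.sum_le_tsum _ fun k _ => herr0 k
      have h2 : 0 ≤ ∑ k ∈ Finset.range n, err k := Finset.sum_nonneg fun k _ => herr0 k
      have h3 := hY0 n ω
      have h4 := hYR n ω
      simp only [hZ, Real.norm_eq_abs]
      exact abs_le.2 ⟨by linarith, by linarith [sq_nonneg R]⟩
    · simp [ENNReal.ofReal]
  have hYlim : ∀ᵐ ω ∂P, ∃ c, Tendsto (fun n => Y n ω) atTop (𝓝 c) := by
    filter_upwards [hsub.exists_ae_tendsto_of_bdd hbdd] with ω ⟨c, hc⟩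
    refine ⟨∑' k, err k - c, ?_⟩
    simpa [hZ] using herrs.hasSum.tendsto_sum_nat.sub hc
  classical
  set g : Ω → ℝ := fun ω => if hω : ∃ c, Tendsto (fun n => Y n ω) atTop (𝓝 c) then hω.choose else 0
    with hg
  have hYg : ∀ᵐ ω ∂P, Tendsto (fun n => Y n ω) atTop (𝓝 (g ω)) := by
    filter_upwards [hYlim] with ω hω
    simp only [hg, dif_pos hω]
    exact hω.choose_spec
  have hYae : ∀ n, AEStronglyMeasurable (Y n) P := fun n => (hYi n).aestronglyMeasurable
  have hg0 : 0 ≤ᵐ[P] g := by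
    filter_upwards [hYg] with ω hω
    exact ge_of_tendsto' hω fun n => hY0 n ω
  have hgR : ∀ᵐ ω ∂P, ‖g ω‖ ≤ R ^ 2 := by
    filter_upwards [hYg, hg0] with ω hω h0
    rw [Real.norm_of_nonneg h0]
    exact le_of_tendsto' hω fun n => hYR n ω
  have hgi : Integrable g P :=
    Integrable.of_bound (aestronglyMeasurable_of_tendsto_ae atTop hYae hYg) _ hgR
  have hint0 : ∫ ω, g ω ∂P = 0 := by
    have h1 : Tendsto (fun n => ∫ ω, Y n ω ∂P) atTop (𝓝 (∫ ω, g ω ∂P)) :=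
      tendsto_integral_of_dominated_convergence (fun _ => R ^ 2) hYae (integrable_const _)
        (fun n => ae_of_all _ fun ω => by
          rw [Real.norm_of_nonneg (hY0 n ω)]
          exact hYR n ω) hYg
    have h2 : Tendsto (fun n => ∫ ω, Y n ω ∂P) atTop (𝓝 0) := by
      refine ((tendsto_add_atTop_iff_nat 1).2 hmean).congr fun n => ?_
      rw [hY, integral_indicator (h.history_le _ _ (measurableSet_stayUpTo π hBm _))]
    exact tendsto_nhds_unique h1 h2
  have hgz : g =ᵐ[P] 0 := (integral_eq_zero_iff_of_nonneg_ae hg0 hgi).1 hint0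
  filter_upwards [hYg, hgz] with ω hω hz hstay
  rw [hz, Pi.zero_apply] at hω
  have h1 : ∀ n, Y n ω = ‖π (n + 1) ω - π'‖ ^ 2 := fun n =>
    Set.indicator_of_mem (stayEvent_subset_stayUpTo π B _ hstay) _
  simp only [h1] at hω
  have h2 : Tendsto (fun n => ‖π (n + 1) ω - π'‖) atTop (𝓝 0) := by
    have := (Real.continuous_sqrt.tendsto 0).comp hω
    simpa [Function.comp_def, Real.sqrt_sq] using this
  exact (tendsto_add_atTop_iff_nat 1).1 (tendsto_iff_norm_sub_tendsto_zero.2 h2)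

/-- Almost sure convergence on the event of staying in the basin, the decay of the mean squared
distance being supplied by its rates. -/
lemma IsPolicyGradient.ae_tendsto_of_improved_bound [IsProbabilityMeasure P]
    (h : G.IsPolicyGradient P γ m p bb sd π V) (hγ : 0 < γ) (hm : 0 ≤ m) {π' : Profile I S A}
    (h' : π' ∈ policies I S A) {lb ls : ℝ} (hp : 1 / 2 < p) (hp1 : p ≤ 1) (hls : 0 ≤ ls)
    (hlb : 1 < p + lb) (hpls : 1 / 2 < p - ls)
    (hbb : bb =O[atTop] (fun n : ℕ => (n : ℝ) ^ (-lb)))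
    (hsd : sd =O[atTop] (fun n : ℕ => (n : ℝ) ^ ls))
    {μ : ℝ} (hμ : 0 < μ) {B : Set (Profile I S A)} (hBm : MeasurableSet B)
    (hQ : G.QuadraticBoundOn π' μ B) {r : ℝ} (hr : 0 < r)
    (himp : ∀ x ∈ policies I S A, ‖x - π'‖ ^ 2 ≤ r →
      inner ℝ (G.gradField x) (x - π') ≤ -(2 * μ) * ‖x - π'‖ ^ 2) :
    ∀ᵐ ω ∂P, ω ∈ stayEvent π B → ω ∈ convergeEvent π π' := by
  obtain ⟨hslow, hfast⟩ := h.isBigO_stayUpTo hγ hm h' hp hp1 hls hlb hpls hbb hsd hμ hBm hQ hr himp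
  have hq : 0 < min lb (p - 2 * ls) := lt_min (by linarith) (by linarith)
  have hzero : ∀ q : ℝ, 0 < q → Tendsto (fun n : ℕ => (n : ℝ) ^ (-q)) atTop (𝓝 0) := fun q hq =>
    (tendsto_rpow_neg_atTop hq).comp tendsto_natCast_atTop_atTop
  refine h.ae_tendsto hγ hm h' (summable_errTerm hγ hm hp hls (by linarith) hlb hpls hbb hsd) hμ
    hBm hQ ?_
  by_cases hc : p = 1 ∧ 2 * μ * γ < min lb (p - 2 * ls)
  · exact (hslow hc).trans_tendsto (hzero _ (by positivity))
  · exact (hfast hc).trans_tendsto (hzero _ hq)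

end Dynamics

end

end StochasticGame

theorem mainTheorem2 {I S : Type*} {A : I → Type*} [Fintype I] [DecidableEq I] [Fintype S]
    [DecidableEq S] [∀ i, Fintype (A i)] (G : StochasticGame I S A)
    (π' : StochasticGame.Profile I S A) (hNash : G.IsNash π') :
    -- a second-order stationary policy admits a basin on which the quadratic bound holds
    (G.IsSecondOrderStationary π' →
      ∃ μ : ℝ, 0 < μ ∧ ∃ B ∈ 𝓝[StochasticGame.policies I S A] π',
        B ⊆ StochasticGame.policies I S A ∧ MeasurableSet B ∧ G.QuadraticBoundOn π' μ B) ∧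
    -- and for every basin on which the quadratic bound holds:
    ∀ (μ : ℝ), 0 < μ →
    ∀ B ∈ 𝓝[StochasticGame.policies I S A] π', B ⊆ StochasticGame.policies I S A →
      MeasurableSet B → G.QuadraticBoundOn π' μ B →
    ∀ (γ p lb ls : ℝ) (bb sd : ℕ → ℝ), 0 < γ → 1 / 2 < p → p ≤ 1 → 0 ≤ ls →
      1 < p + lb → 1 / 2 < p - ls →
      bb =O[atTop] (fun n : ℕ => (n : ℝ) ^ (-lb)) →
      sd =O[atTop] (fun n : ℕ => (n : ℝ) ^ ls) →
    -- high-probability containment and convergence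
    (∃ U ∈ 𝓝[StochasticGame.policies I S A] π', U ⊆ StochasticGame.policies I S A ∧
      MeasurableSet U ∧
      ∀ δ : ℝ, 0 < δ → ∃ m₀ : ℝ, 0 ≤ m₀ ∧ ∀ m : ℝ, m₀ ≤ m →
        ∀ (Ω : Type*) [MeasurableSpace Ω] (P : Measure Ω) [IsProbabilityMeasure P]
          (π V : ℕ → Ω → StochasticGame.Profile I S A),
          G.IsPolicyGradient P γ m p bb sd π V →
          P {ω | π 1 ω ∈ U} ≠ 0 →
          1 - δ ≤ (ProbabilityTheory.cond P {ω | π 1 ω ∈ U}).real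
              (StochasticGame.stayEvent π B) ∧
          1 - δ ≤ (ProbabilityTheory.cond P {ω | π 1 ω ∈ U}).real
              (StochasticGame.convergeEvent π π')) ∧
    -- almost sure convergence on the containment event, and the rate conditioned on it
    (∀ m : ℝ, 0 ≤ m →
      ∀ (Ω : Type*) [MeasurableSpace Ω] (P : Measure Ω) [IsProbabilityMeasure P]
        (π V : ℕ → Ω → StochasticGame.Profile I S A),
        G.IsPolicyGradient P γ m p bb sd π V →
        (∀ᵐ ω ∂P, ω ∈ StochasticGame.stayEvent π B →
          ω ∈ StochasticGame.convergeEvent π π') ∧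
        ((p = 1 ∧ 2 * μ * γ < min lb (p - 2 * ls)) →
          (fun n : ℕ => ∫ ω, ‖π n ω - π'‖ ^ 2
              ∂(ProbabilityTheory.cond P (StochasticGame.stayEvent π B)))
            =O[atTop] (fun n : ℕ => (n : ℝ) ^ (-(2 * μ * γ)))) ∧
        (¬ (p = 1 ∧ 2 * μ * γ < min lb (p - 2 * ls)) →
          (fun n : ℕ => ∫ ω, ‖π n ω - π'‖ ^ 2
              ∂(ProbabilityTheory.cond P (StochasticGame.stayEvent π B)))
            =O[atTop] (fun n : ℕ => (n : ℝ) ^ (-(min lb (p - 2 * ls)))))) := by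
  have h' := hNash.1
  refine ⟨fun h => h.exists_quadraticBoundOn, ?_⟩
  intro μ hμ B hB hBsub hBm hQ γ p lb ls bb sd hγ hp hp1 hls hlb hpls hbb hsd
  have hlb0 : 0 ≤ lb := by linarith
  obtain ⟨r₀, hr₀, himp⟩ := hNash.exists_improved_bound hμ hB hQ
  constructor
  · obtain ⟨R, hR⟩ := StochasticGame.exists_dist_bound π'
    obtain ⟨Gb, hGb⟩ := G.exists_gradField_bound
    obtain ⟨ε, hε, hball⟩ := Metric.mem_nhdsWithin_iff.1 hB
    -- half the radius of a ball inside the basin, so that `D` must grow fourfold before an exit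
    refine ⟨StochasticGame.policies I S A ∩ Metric.ball π' (ε / 2),
      inter_mem_nhdsWithin _ (Metric.ball_mem_nhds _ (half_pos hε)), Set.inter_subset_left,
      StochasticGame.isClosed_policies.measurableSet.inter Metric.isOpen_ball.measurableSet, ?_⟩
    intro δ hδ
    have hlim := (StochasticGame.tendsto_tsum_errTerm hγ hp hls hlb0 hlb hpls hbb hsd).const_mul
      (StochasticGame.stepConst R Gb (2 * R ^ 2) 1)
    rw [mul_zero] at hlim
    obtain ⟨m₀, hm₀⟩ := eventually_atTop.1 (hlim.eventually
      (gt_mem_nhds (show 0 < 9 * (ε / 2) ^ 4 * δ by positivity)))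
    refine ⟨max m₀ 0, le_max_right _ _, fun m hmm Ω _ P _ π V hPG hU => ?_⟩
    have hm : 0 ≤ m := (le_max_right _ _).trans hmm
    set U := StochasticGame.policies I S A ∩ Metric.ball π' (ε / 2) with hUdef
    have hUm : MeasurableSet U :=
      StochasticGame.isClosed_policies.measurableSet.inter Metric.isOpen_ball.measurableSet
    have hU₁ : MeasurableSet {ω | π 1 ω ∈ U} := hPG.measurable 1 le_rfl hUm
    have hexit := hPG.measure_diff_stayEvent_le hγ hm h' hR hGb
      (StochasticGame.summable_errTerm hγ hm hp hls hlb0 hlb hpls hbb hsd) hμ hBm hUm hQ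
      (half_pos hε) (fun x hx hxB => by
        by_contra hcon
        refine hxB (hball ⟨?_, hx⟩)
        rw [mem_ball_iff_norm]
        linarith) (fun x hx => by
        have := hx.2
        rw [mem_ball_iff_norm] at this
        exact this.le) fun x hx => hball ⟨Metric.ball_subset_ball (by linarith) hx.2, hx.1⟩
    have hPU : 0 < P.real {ω | π 1 ω ∈ U} := ENNReal.toReal_pos hU (measure_ne_top _ _)
    have hdiff : P.real ({ω | π 1 ω ∈ U} \ StochasticGame.stayEvent π B) ≤
        δ * P.real {ω | π 1 ω ∈ U} := by
      have h1 := mul_le_mul_of_nonneg_right (hm₀ m ((le_max_left _ _).trans hmm)).le hPU.le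
      have h2 : 0 < 9 * (ε / 2) ^ 4 := by positivity
      refine le_of_mul_le_mul_left ?_ h2
      linarith
    have hcond : 1 - δ ≤ (ProbabilityTheory.cond P {ω | π 1 ω ∈ U}).real
        (StochasticGame.stayEvent π B) := by
      have h1 : P.real {ω | π 1 ω ∈ U} ≤
          P.real ({ω | π 1 ω ∈ U} ∩ StochasticGame.stayEvent π B) +
          P.real ({ω | π 1 ω ∈ U} \ StochasticGame.stayEvent π B) := by
        refine le_trans (le_of_eq ?_) (measureReal_union_le _ _)
        rw [Set.inter_union_sdiff]
      rw [measureReal_def, ProbabilityTheory.cond_apply hU₁, ENNReal.toReal_mul, ENNReal.toReal_inv,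
        ← measureReal_def, ← measureReal_def, ← div_eq_inv_mul, le_div_iff₀ hPU]
      linarith
    have := ProbabilityTheory.cond_isProbabilityMeasure (μ := P) hU
    refine ⟨hcond, hcond.trans ?_⟩
    have hae := ProbabilityTheory.cond_absolutelyContinuous (μ := P) (s := {ω | π 1 ω ∈ U})
      |>.ae_le (hPG.ae_tendsto_of_improved_bound hγ hm h' hp hp1 hls hlb hpls hbb hsd hμ hBm hQ
        hr₀ himp)
    exact ENNReal.toReal_mono (measure_ne_top _ _) (measure_mono_ae hae)
  · intro m hm Ω _ P _ π V hPG
    obtain ⟨hslow, hfast⟩ := hPG.isBigO_stayUpTo hγ hm h' hp hp1 hls hlb hpls hbb hsd hμ hBm hQ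
      hr₀ himp
    have hO := hPG.integral_cond_isBigO π' B
    exact ⟨hPG.ae_tendsto_of_improved_bound hγ hm h' hp hp1 hls hlb hpls hbb hsd hμ hBm hQ hr₀ himp,
      fun hc => hO.trans (hslow hc), fun hc => hO.trans (hfast hc)⟩
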